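/- Let $n$ be the number of modes, $d$ a positive odd integer, $\ell=\sqrt{2\pi/d}$, and $\mathcal H=L^2(\mathbb R^n)$. Write $\mathbf a=(\mathbf a_X,\mathbf a_Z)\in\mathbb R^{2n}$, $[\mathbf a,\mathbf b]=\mathbf a_X\cdot\mathbf b_Z-\mathbf a_Z\cdot\mathbf b_X$, and let $\hat T_{\mathbf a}=e^{i\pi\mathbf a_X\cdot\mathbf a_Z/d}\,e^{-i\ell\mathbf a_X\cdot\hat{\mathbf p}}\,e^{i\ell\mathbf a_Z\cdot\hat{\mathbf q}}$ be the displacement operators, that is, $(\hat T_{\mathbf a}\psi)(\mathbf q)=e^{i\pi\mathbf a_X\cdot\mathbf a_Z/d}\,e^{i\ell\mathbf a_Z\cdot(\mathbf q-\ell\mathbf a_X)}\,\psi(\mathbf q-\ell\mathbf a_X)$. Let $\mathcal A$ be the set of trace-class operators $\hat C$ on $\mathcal H$ with $\sum_{\mathbf a\in\mathbb Z^{2n}}|\mathrm{Tr}(\hat C\hat T_{\mathbf a})|<\infty$. For $\hat C\in\mathcal A$ the Zak-Gross Wigner function is $$W_{\hat C}(\boldsymbol\eta)=\frac1{(2\pi)^n}\sum_{\mathbf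 a\in\mathbb Z^{2n}}e^{i\ell[\mathbf a,\boldsymbol\eta]+i\pi\mathbf a_X\cdot\mathbf a_Z}\,\mathrm{Tr}(\hat C\hat T_{\mathbf a}),\qquad\boldsymbol\eta\in\mathbb R^{2n},$$ which is $d\ell$-periodic in every coordinate. Let $\int d\boldsymbol\eta$ be the integral over $[0,d\ell)^{2n}$ against $d^{-n}$ times Lebesgue measure (total mass $(2\pi)^n$). For $j\in\{0,\dots,d-1\}^n$ let $|j_{\rm GKP}\rangle=\ell^{-n/2}\sum_{\mathbf m\in\mathbb Z^n}|\ell(d\mathbf m+j)\rangle$ (a tempered distribution), $\hat P_{\mathbf 0}=\sum_j|j_{\rm GKP}\rangle\langle j_{\rm GKP}|$, $\hat P_{\mathbf s}=\hat T_{\mathbf s}\hat P_{\mathbf 0}\hat T_{-\mathbf s}$, and let $\int d\mathbf s$ be the integral over $[0,1)^{2n}$ against $\ell^{2n}$ times Lebesgue measure (so that $\int d\mathbf s\,\hat P_{\mathbf s}=\mathbb 1$). The twirl $\mathcal E(\hat C)=\int d\mathbf s\,\hat P_{\mathbf s}\hat C\hat P_{\mathbf s}$ is the bounded operator with $\langle\varphi,\mathcal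 E(\hat C)\psi\rangle=\sum_i\int d\mathbf s\,\langle\varphi|\hat P_{\mathbf s}|\alpha_i\rangle\langle\beta_i|\hat P_{\mathbf s}|\psi\rangle$ for all Schwartz functions $\varphi,\psi$ and every expansion $\hat C=\sum_i|\alpha_i\rangle\langle\beta_i|$ with Schwartz functions $\alpha_i,\beta_i$ and $\sum_i\|\alpha_i\|\|\beta_i\|<\infty$. Then, for all $\hat C,\hat D\in\mathcal A$ and $\boldsymbol\eta\in\mathbb R^{2n}$: 1. (Linearity) $\hat C+\hat D\in\mathcal A$ and $c\,\hat C\in\mathcal A$ for $c\in\mathbb C$, with $W_{\hat C+\hat D}=W_{\hat C}+W_{\hat D}$ and $W_{c\hat C}=c\,W_{\hat C}$. 2. (Reality) $\hat C^\dagger\in\mathcal A$ and $W_{\hat C^\dagger}(\boldsymbol\eta)=W_{\hat C}(\boldsymbol\eta)^*$. 3. (Standardization) $W_{\hat C}$ is integrable and $\int d\boldsymbol\eta\,W_{\hat C}(\boldsymbol\eta)=\mathrm{Tr}(\hat C)$. 4. (Covariance) For all $\mathbf b\in\mathbb R^{2n}$, $\hat T_{\mathbf b}\hat C\hat T_{\mathbf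 b}^\dagger\in\mathcal A$ and $W_{\hat T_{\mathbf b}\hat C\hat T_{\mathbf b}^\dagger}(\boldsymbol\eta)=W_{\hat C}(\boldsymbol\eta-\ell\mathbf b)$. 5. (Traciality) $\mathcal E(\hat C)$ and $\mathcal E(\hat D)$ exist, $\mathcal E(\hat C)\hat D$ and $\hat C\mathcal E(\hat D)$ are trace class, $W_{\hat C}W_{\hat D}$ is integrable, and $$\int d\boldsymbol\eta\,W_{\hat C}(\boldsymbol\eta)W_{\hat D}(\boldsymbol\eta)=\mathrm{Tr}(\mathcal E(\hat C)\hat D)=\mathrm{Tr}(\hat C\,\mathcal E(\hat D))=\tau(\mathcal E(\hat C)\mathcal E(\hat D)).$$ Here $\tau$ is the trace per stabilizer: $\tau(\hat X)=(2\pi/d)^n\sum_{j\in\{0,\dots,d-1\}^n}\langle\chi_j,\hat X\chi_j\rangle$, where $\chi_j=\ell^{-n/2}\mathbf 1_{\ell(j+[0,1)^n)}$. (The vectors $\hat T_{d\mathbf a}\chi_j$, $\mathbf a\in\mathbb Z^{2n}$, form an orthonormal basis of $\mathcal H$; twirled operators commute with all stabilizers $\hat T_{d\mathbf a}$, so that their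 ordinary trace is a sum of infinitely many equal contributions, one for each $\mathbf a$. The normalization is the one with $\tau(\mathcal E(\hat C))=\mathrm{Tr}(\hat C)$.) -/

import Mathlib

open MeasureTheory
open scoped SchwartzMap InnerProductSpace

noncomputable section

namespace ZakGross

/-! ### Phase space -/

/-- Phase-space vectors `a = (a_X, a_Z)` of length `2n`. -/
abbrev Phase (n : ℕ) : Type := (Fin n → ℝ) × (Fin n → ℝ)

/-- The integer lattice `ℤ^{2n}`. -/
abbrev Lattice (n : ℕ) : Type := (Fin n → ℤ) × (Fin n → ℤ)

/-- An integer vector regarded as a real phase-space vector. -/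
def Lattice.toPhase {n : ℕ} (a : Lattice n) : Phase n :=
  (fun i => (a.1 i : ℝ), fun i => (a.2 i : ℝ))

/-- The symplectic form `[a, b] = a_X ⬝ b_Z - a_Z ⬝ b_X`. -/
def symp {n : ℕ} (a b : Phase n) : ℝ := a.1 ⬝ᵥ b.2 - a.2 ⬝ᵥ b.1

/-- The length `ℓ = √(2π/d)`. -/
def ell (d : ℕ) : ℝ := Real.sqrt (2 * Real.pi / d)

/-! ### The Hilbert space of `n` modes and the displacement operators -/

/-- The Hilbert space `L²(ℝⁿ; ℂ)` of `n` modes, in the position representation. -/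
abbrev Modes (n : ℕ) : Type := Lp ℂ 2 (volume : Measure (Fin n → ℝ))

/-- `exp (-i ℓ x ⬝ p̂)` on wave functions: the translation by `ℓ x`. -/
def shiftX {n : ℕ} (d : ℕ) (x : Fin n → ℝ) (f : (Fin n → ℝ) → ℂ) : (Fin n → ℝ) → ℂ :=
  fun q => f (q - ell d • x)

/-- `exp (i ℓ z ⬝ q̂)` on wave functions: the multiplication by `exp (i ℓ z ⬝ q)`. -/
def modZ {n : ℕ} (d : ℕ) (z : Fin n → ℝ) (f : (Fin n → ℝ) → ℂ) : (Fin n → ℝ) → ℂ :=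
  fun q => Complex.exp (Complex.I * ((ell d * (z ⬝ᵥ q) : ℝ) : ℂ)) * f q

/-- The displacement `T_a = exp (i π a_X ⬝ a_Z / d) exp (-i ℓ a_X ⬝ p̂) exp (i ℓ a_Z ⬝ q̂)`
on wave functions. -/
def dispFun {n : ℕ} (d : ℕ) (a : Phase n) (f : (Fin n → ℝ) → ℂ) : (Fin n → ℝ) → ℂ :=
  fun q => Complex.exp (Complex.I * ((Real.pi * (a.1 ⬝ᵥ a.2) / d : ℝ) : ℂ)) *
    shiftX d a.1 (modZ d a.2 f) q

theorem dispFun_apply {n : ℕ} (d : ℕ) (a : Phase n) (f : (Fin n → ℝ) → ℂ) (q : Fin n → ℝ) :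
    dispFun d a f q = Complex.exp (Complex.I * ((Real.pi * (a.1 ⬝ᵥ a.2) / d : ℝ) : ℂ)) *
      (Complex.exp (Complex.I * ((ell d * (a.2 ⬝ᵥ (q - ell d • a.1)) : ℝ) : ℂ)) *
        f (q - ell d • a.1)) := rfl

theorem norm_dispFun {n : ℕ} (d : ℕ) (a : Phase n) (f : (Fin n → ℝ) → ℂ) (q : Fin n → ℝ) :
    ‖dispFun d a f q‖ = ‖f (q - ell d • a.1)‖ := by
  rw [dispFun_apply, norm_mul, norm_mul, Complex.norm_exp_I_mul_ofReal,
    Complex.norm_exp_I_mul_ofReal, one_mul, one_mul]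

theorem measurePreserving_shift {n : ℕ} (c : Fin n → ℝ) :
    MeasurePreserving (fun q : Fin n → ℝ => q - c) volume volume :=
  measurePreserving_sub_right volume c

theorem dispFun_congr {n : ℕ} (d : ℕ) (a : Phase n) {f g : (Fin n → ℝ) → ℂ}
    (h : f =ᵐ[volume] g) : dispFun d a f =ᵐ[volume] dispFun d a g := by
  have := (measurePreserving_shift (ell d • a.1)).quasiMeasurePreserving.ae_eq_comp h
  filter_upwards [this] with q hq
  simp only [Function.comp_apply] at hq
  rw [dispFun_apply, dispFun_apply, hq]

theorem eLpNorm_dispFun {n : ℕ} (d : ℕ) (a : Phase n) {f : (Fin n → ℝ) → ℂ}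
    (hf : AEStronglyMeasurable f volume) :
    eLpNorm (dispFun d a f) 2 volume = eLpNorm f 2 volume := by
  rw [← eLpNorm_comp_measurePreserving hf (measurePreserving_shift (ell d • a.1))]
  exact eLpNorm_congr_norm_ae (Filter.Eventually.of_forall fun q => norm_dispFun d a f q)

theorem memLp_dispFun {n : ℕ} (d : ℕ) (a : Phase n) {f : (Fin n → ℝ) → ℂ}
    (hf : MemLp f 2 volume) : MemLp (dispFun d a f) 2 volume := by
  refine ⟨?_, (eLpNorm_dispFun d a hf.1).trans_lt hf.2⟩
  have h1 : AEStronglyMeasurable (fun q : Fin n → ℝ => f (q - ell d • a.1)) volume :=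
    hf.1.comp_measurePreserving (measurePreserving_shift (ell d • a.1))
  have h2 : Continuous fun q : Fin n → ℝ =>
      Complex.exp (Complex.I * ((ell d * (a.2 ⬝ᵥ (q - ell d • a.1)) : ℝ) : ℂ)) := by
    unfold dotProduct
    fun_prop
  exact (h2.aestronglyMeasurable.mul h1).const_mul _

/-- The displacement operator `T_a` on `L²(ℝⁿ)`. -/
def disp {n : ℕ} (d : ℕ) (a : Phase n) : Modes n →L[ℂ] Modes n :=
  LinearIsometry.toContinuousLinearMap
    { toFun := fun ψ => (memLp_dispFun d a (Lp.memLp ψ)).toLp (dispFun d a ψ)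
      map_add' := fun ψ χ => by
        rw [← MemLp.toLp_add]
        refine (MemLp.toLp_eq_toLp_iff _ _).2 ?_
        refine (dispFun_congr d a (Lp.coeFn_add ψ χ)).trans ?_
        refine Filter.Eventually.of_forall fun q => ?_
        simp only [dispFun_apply, Pi.add_apply]
        ring
      map_smul' := fun c ψ => by
        rw [RingHom.id_apply, ← MemLp.toLp_const_smul]
        refine (MemLp.toLp_eq_toLp_iff _ _).2 ?_
        refine (dispFun_congr d a (Lp.coeFn_smul c ψ)).trans ?_
        refine Filter.Eventually.of_forall fun q => ?_
        simp only [dispFun_apply, Pi.smul_apply, smul_eq_mul]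
        ring
      norm_map' := fun ψ => by
        change ‖(memLp_dispFun d a (Lp.memLp ψ)).toLp (dispFun d a ψ)‖ = ‖ψ‖
        rw [Lp.norm_toLp, eLpNorm_dispFun d a (Lp.memLp ψ).1, ← Lp.norm_def] }

theorem coeFn_disp {n : ℕ} (d : ℕ) (a : Phase n) (ψ : Modes n) :
    disp d a ψ =ᵐ[volume] dispFun d a ψ :=
  MemLp.coeFn_toLp (memLp_dispFun d a (Lp.memLp ψ))

/-! ### Trace-class operators and the trace -/

/-- Trace-class (nuclear) operators: sums of rank-one operators `|α_i⟩⟨β_i|` with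
`∑ ‖α_i‖ ‖β_i‖ < ∞`. -/
def IsTraceClass {n : ℕ} (C : Modes n →L[ℂ] Modes n) : Prop :=
  ∃ α β : ℕ → Modes n, Summable (fun i => ‖α i‖ * ‖β i‖) ∧
    HasSum (fun i => InnerProductSpace.rankOne ℂ (α i) (β i)) C

/-- The vectors of an orthonormal (Hilbert) basis of `L²(ℝⁿ)`. -/
def basisSet (n : ℕ) : Set (Modes n) := Classical.choose (exists_hilbertBasis ℂ (Modes n))

/-- The trace `Tr C = ∑_e ⟨e, C e⟩` over an orthonormal basis (for trace-class `C` the sum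
converges absolutely and does not depend on the basis). -/
def trace {n : ℕ} (C : Modes n →L[ℂ] Modes n) : ℂ :=
  ∑' e : basisSet n, ⟪(e : Modes n), C e⟫_ℂ

/-! ### The Zak-Gross Wigner function -/

/-- The operators for which the Zak-Gross Wigner function is defined: trace-class operators for
which the series over `ℤ^{2n}` converges absolutely. As the phase factors have modulus one, this
does not depend on the phase-space point. -/
def HasWigner {n : ℕ} (d : ℕ) (C : Modes n →L[ℂ] Modes n) : Prop :=
  IsTraceClass C ∧ Summable fun a : Lattice n => ‖trace (C * disp d a.toPhase)‖

/-- The Zak-Gross Wigner function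
`W_C(η) = (2π)⁻ⁿ ∑_{a ∈ ℤ^{2n}} exp (i ℓ [a, η] + i π a_X ⬝ a_Z) Tr (C T_a)`. -/
def wigner {n : ℕ} (d : ℕ) (C : Modes n →L[ℂ] Modes n) (η : Phase n) : ℂ :=
  1 / (2 * (Real.pi : ℂ)) ^ n * ∑' a : Lattice n,
    Complex.exp (Complex.I * ((ell d * symp a.toPhase η : ℝ) : ℂ) +
      Complex.I * ((Real.pi * (a.toPhase.1 ⬝ᵥ a.toPhase.2) : ℝ) : ℂ)) *
    trace (C * disp d a.toPhase)

/-- The box `[0, r)^{2n}`. -/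
def box (n : ℕ) (r : ℝ) : Set (Phase n) :=
  (Set.univ.pi fun _ => Set.Ico 0 r) ×ˢ (Set.univ.pi fun _ => Set.Ico 0 r)

/-- The measure `dη` on the torus `[0, dℓ)^{2n}`: Lebesgue measure divided by `dⁿ`, that is, the
invariant measure of total mass `(2π)ⁿ`, so that
`(2π)⁻ⁿ ∫ exp (i ℓ [a, η]) dη = δ_{a,0}` for integer `a`. -/
def torusMeasure (n d : ℕ) : Measure (Phase n) :=
  ENNReal.ofReal ((d : ℝ) ^ n)⁻¹ • volume.restrict (box n (d * ell d))

/-! ### GKP projectors and the twirl -/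

/-- The pairing `⟨j_GKP | f⟩ = ℓ^{-n/2} ∑_{m ∈ ℤⁿ} f (ℓ (d m + j))` of the `n`-mode GKP basis
state `|j_GKP⟩ = ⨂ₖ ℓ^{-1/2} ∑_{mₖ} |(d mₖ + jₖ) ℓ⟩` with a wave function `f`. -/
def gkpBra {n : ℕ} (d : ℕ) (j : Fin n → Fin d) (f : (Fin n → ℝ) → ℂ) : ℂ :=
  (((Real.sqrt (ell d))⁻¹ ^ n : ℝ) : ℂ) *
    ∑' m : Fin n → ℤ, f fun k => ell d * ((d : ℝ) * (m k : ℝ) + ((j k : ℕ) : ℝ))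

/-- The form `⟨f | P_s | g⟩` of the displaced GKP projector
`P_s = T_s (∑_j |j_GKP⟩⟨j_GKP|) T_{-s}`, where `T_s† = T_{-s}`. -/
def gkpForm {n : ℕ} (d : ℕ) (s : Phase n) (f g : (Fin n → ℝ) → ℂ) : ℂ :=
  ∑ j : Fin n → Fin d,
    starRingEnd ℂ (gkpBra d j (dispFun d (-s) f)) * gkpBra d j (dispFun d (-s) g)

/-- The measure `ds` on the unit cell `[0, 1)^{2n}` of syndromes: Lebesgue measure times
`ℓ^{2n}`, which is the normalization for which `∫ P_s ds = 1`. -/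
def cellMeasure (n d : ℕ) : Measure (Phase n) :=
  ENNReal.ofReal (ell d ^ (2 * n)) • volume.restrict (box n 1)

/-- `E = ∫ P_s C P_s ds` in the weak sense. As `P_s` maps Schwartz functions to tempered
distributions, the trace-class operator `C` is written as a trace-norm convergent sum of
rank-one operators `|α_i⟩⟨β_i|` with Schwartz functions `α_i`, `β_i` (such expansions exist, since
Schwartz functions are dense in `L²`), and the bounded operator `E` has the matrix elements
`⟨φ, E ψ⟩ = ∑_i ∫ ⟨φ|P_s|α_i⟩ ⟨β_i|P_s|ψ⟩ ds` for all Schwartz functions `φ`, `ψ`, whatever the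
expansion. -/
def IsTwirl {n : ℕ} (d : ℕ) (C E : Modes n →L[ℂ] Modes n) : Prop :=
  ∀ α β : ℕ → 𝓢(Fin n → ℝ, ℂ),
    Summable (fun i => ‖(α i).toLp 2 volume‖ * ‖(β i).toLp 2 volume‖) →
    HasSum (fun i => InnerProductSpace.rankOne ℂ ((α i).toLp 2 volume) ((β i).toLp 2 volume)) C →
    ∀ φ ψ : 𝓢(Fin n → ℝ, ℂ),
      (∀ i, Integrable (fun s => gkpForm d s φ (α i) * gkpForm d s (β i) ψ) (cellMeasure n d)) ∧
      HasSum (fun i => ∫ s, gkpForm d s φ (α i) * gkpForm d s (β i) ψ ∂cellMeasure n d)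
        ⟪φ.toLp 2 volume, E (ψ.toLp 2 volume)⟫_ℂ

open Classical in
/-- The twirling map `C ↦ ℰ(C) = ∫ P_s C P_s ds` (and `0` if there is no such bounded
operator). -/
def twirl {n : ℕ} (d : ℕ) (C : Modes n →L[ℂ] Modes n) : Modes n →L[ℂ] Modes n :=
  if h : ∃ E, IsTwirl d C E then Classical.choose h else 0

/-! ### The trace on operators that commute with the stabilizers -/

/-- The cube `ℓ (j + [0, 1)ⁿ)` in position space. -/
def posCell {n : ℕ} (d : ℕ) (j : Fin n → Fin d) : Set (Fin n → ℝ) :=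
  Set.univ.pi fun k => Set.Ico (ell d * ((j k : ℕ) : ℝ)) (ell d * (((j k : ℕ) : ℝ) + 1))

theorem measurableSet_posCell {n : ℕ} (d : ℕ) (j : Fin n → Fin d) :
    MeasurableSet (posCell d j) :=
  MeasurableSet.univ_pi fun _ => measurableSet_Ico

theorem volume_posCell_ne_top {n : ℕ} (d : ℕ) (j : Fin n → Fin d) :
    volume (posCell d j) ≠ ⊤ := by
  rw [posCell, Real.volume_pi_Ico]
  exact ENNReal.prod_ne_top fun _ _ => ENNReal.ofReal_ne_top

/-- The normalized indicator function `ℓ^{-n/2} 1` of the cube `ℓ (j + [0, 1)ⁿ)`. The vectors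
`T_{d a} (cellVec d j)`, for `a ∈ ℤ^{2n}` and `j ∈ {0, …, d-1}ⁿ`, are an orthonormal basis of
`L²(ℝⁿ)`. -/
def cellVec {n : ℕ} (d : ℕ) (j : Fin n → Fin d) : Modes n :=
  indicatorConstLp 2 (measurableSet_posCell d j) (volume_posCell_ne_top d j)
    (((Real.sqrt (ell d))⁻¹ ^ n : ℝ) : ℂ)

/-- The trace per stabilizer, for operators `X` that commute with all the stabilizers `T_{d a}`,
`a ∈ ℤ^{2n}`. The ordinary trace of such an `X`, computed in the basis `T_{d a} (cellVec d j)`, is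
the sum over `a ∈ ℤ^{2n}` of copies of one and the same number `∑_j ⟨cellVec d j, X cellVec d j⟩`;
this number is kept once, times `(2π/d)ⁿ`, the normalization with `cellTrace d (twirl d C) = Tr C`
(as `ℰ(C) = (d/2π)ⁿ ∑_a T_{d a} C T_{d a}†`). -/
def cellTrace {n : ℕ} (d : ℕ) (X : Modes n →L[ℂ] Modes n) : ℂ :=
  ((2 * Real.pi / d : ℝ) : ℂ) ^ n * ∑ j : Fin n → Fin d, ⟪cellVec d j, X (cellVec d j)⟫_ℂ

end ZakGross

end

noncomputable section

namespace ZakGross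

/-! ### Nuclear expansions and the trace -/

/-! Everything is read off the characteristic function χ_C(a) = Tr(C T_a) on ℤ^{2n}; W_C is its
absolutely convergent Fourier series, up to signs. Linearity, reality and covariance hold term by
term: the trace is linear, χ of the adjoint at a is the conjugate of χ_C(-a), and by the Weyl
relations conjugation by T_b multiplies χ_C by a character. Orthogonality of characters on the torus
gives standardization and ∫ W_C W_D = (2π)⁻ⁿ ∑_a χ_C(a) χ_D(-a) (`HasWigner.integral_wigner_mul`).

The core of traciality is the norm-convergent expansion ℰ(C) = (2π)⁻ⁿ ∑_a χ_C(-a) T_a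
(`HasWigner.twirl_eq`). Tested on Schwartz functions it reduces to ∑_a ⟨φ, T_a ψ⟩⟨β, T_{-a} α⟩ =
(2π)ⁿ ∫ ⟨φ|P_s|α⟩⟨β|P_s|ψ⟩ ds (`tsum_corr_mul_conj`). Split the position part of the lattice vector
into residues r mod d. For fixed r the matrix elements are, after rescaling, the Fourier
coefficients of a product of Zak transforms, conj(Zφ) times the translate of Zψ by r/d. Parseval
turns the sum into an integral of four Zak factors, which regroup into the pairs (φ, α) and (β, ψ).
A GKP state being a Dirac comb, ⟨f|P_s|g⟩ is a sum over j of conj(Zf) Zg at ((j + s_X)/d, s_Z);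
summing over r and cutting the unit cube into dⁿ cells produces the product of the two forms.

Rapid decay of ⟨φ, T_a ψ⟩ justifies the interchanges, and Schwartz expansions of trace-class
operators make the twirl unique. The traces are then taken term by term, using that A ↦ Tr(A D) and
τ are norm continuous and that τ(T_a) = (2π)ⁿ δ_{a,0} on the lattice. -/

/-- `C` is the trace-norm convergent sum of the rank-one operators `|α_i⟩⟨β_i|`. -/
def IsNuclearSum {n : ℕ} {ι : Type*} (α β : ι → Modes n) (C : Modes n →L[ℂ] Modes n) : Prop :=
  Summable (fun i => ‖α i‖ * ‖β i‖) ∧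
    HasSum (fun i => InnerProductSpace.rankOne ℂ (α i) (β i)) C

section NuclearSum

variable {n : ℕ} {ι κ : Type*} {α β : ι → Modes n} {C : Modes n →L[ℂ] Modes n}

theorem IsNuclearSum.isTraceClass [Denumerable ι] (h : IsNuclearSum α β C) : IsTraceClass C := by
  let e := (Denumerable.eqv ι).symm
  exact ⟨α ∘ e, β ∘ e, (e.summable_iff (f := fun i => ‖α i‖ * ‖β i‖)).2 h.1,
    (e.hasSum_iff (f := fun i => InnerProductSpace.rankOne ℂ (α i) (β i))).2 h.2⟩

theorem IsNuclearSum.mul_left (h : IsNuclearSum α β C) (A : Modes n →L[ℂ] Modes n) :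
    IsNuclearSum (fun i => A (α i)) β (A * C) := by
  refine ⟨Summable.of_nonneg_of_le (fun i => by positivity) (fun i => ?_) (h.1.mul_left ‖A‖), ?_⟩
  · rw [← mul_assoc]
    exact mul_le_mul_of_nonneg_right (A.le_opNorm _) (norm_nonneg _)
  · have := h.2.mul_left A
    refine this.congr_fun fun i => ?_
    ext1 x
    simp

theorem IsNuclearSum.adjoint (h : IsNuclearSum α β C) :
    IsNuclearSum β α (ContinuousLinearMap.adjoint C) := by
  refine ⟨by simpa only [mul_comm] using h.1, ?_⟩
  have := h.2.map (ContinuousLinearMap.adjoint (𝕜 := ℂ) (E := Modes n) (F := Modes n))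
    (ContinuousLinearMap.adjoint (𝕜 := ℂ) (E := Modes n) (F := Modes n)).continuous
  refine this.congr_fun fun i => ?_
  simp

theorem IsNuclearSum.mul_right (h : IsNuclearSum α β C) (A : Modes n →L[ℂ] Modes n) :
    IsNuclearSum α (fun i => ContinuousLinearMap.adjoint A (β i)) (C * A) := by
  have := (h.adjoint.mul_left (ContinuousLinearMap.adjoint A)).adjoint
  simpa [ContinuousLinearMap.mul_def, ContinuousLinearMap.adjoint_comp] using this

theorem IsNuclearSum.smul (h : IsNuclearSum α β C) (c : ℂ) :
    IsNuclearSum (fun i => c • α i) β (c • C) := by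
  simpa using h.mul_left (c • (1 : Modes n →L[ℂ] Modes n))

theorem IsNuclearSum.add {α' β' : κ → Modes n} {D : Modes n →L[ℂ] Modes n}
    (h : IsNuclearSum α β C) (h' : IsNuclearSum α' β' D) :
    IsNuclearSum (Sum.elim α α') (Sum.elim β β') (C + D) := by
  refine ⟨?_, ?_⟩
  · exact (HasSum.sum (f := fun i => ‖Sum.elim α α' i‖ * ‖Sum.elim β β' i‖)
      h.1.hasSum h'.1.hasSum).summable
  · exact HasSum.sum
      (f := fun i => InnerProductSpace.rankOne ℂ (Sum.elim α α' i) (Sum.elim β β' i)) h.2 h'.2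

/-- Cauchy–Schwarz in ℓ² for the two coefficient sequences, whose ℓ² norms are ‖x‖ and ‖y‖ by
Parseval. -/
theorem summable_norm_inner_mul_inner {E : Type*} [NormedAddCommGroup E] [InnerProductSpace ℂ E]
    [CompleteSpace E] (b : HilbertBasis κ ℂ E) (x y : E) :
    Summable (fun e => ‖⟪x, b e⟫_ℂ‖ * ‖⟪b e, y⟫_ℂ‖) ∧
      ∑' e, ‖⟪x, b e⟫_ℂ‖ * ‖⟪b e, y⟫_ℂ‖ ≤ ‖x‖ * ‖y‖ := by
  have key : ∀ z : E, HasSum (fun e => ‖⟪z, b e⟫_ℂ‖ ^ (2 : ℝ)) (‖z‖ ^ (2 : ℝ)) := fun z => by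
    have := b.hasSum_inner_mul_inner z z
    rw [inner_self_eq_norm_sq_to_K] at this
    have h2 := Complex.hasSum_re this
    simp only [Real.rpow_two]
    convert! h2 using 1
    · ext e
      rw [← inner_conj_symm (b e) z, Complex.mul_conj, Complex.ofReal_re, Complex.normSq_eq_norm_sq]
    · simp [← Complex.ofReal_pow]
  have h := Real.inner_le_Lp_mul_Lq_hasSum_of_nonneg (f := fun e => ‖⟪x, b e⟫_ℂ‖)
    (g := fun e => ‖⟪b e, y⟫_ℂ‖) Real.HolderConjugate.two_two (norm_nonneg x) (norm_nonneg y)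
    (fun _ => norm_nonneg _) (fun _ => norm_nonneg _) (key x)
    (by simpa only [norm_inner_symm] using key y)
  obtain ⟨c, -, hc, hs⟩ := h
  exact ⟨hs.summable, hs.tsum_eq.trans_le hc⟩

/-- Absolute convergence over pairs (rank-one term, basis vector), which allows the sums to be
exchanged in `IsNuclearSum.hasSum_trace`. -/
theorem summable_of_norm_inner_mul_inner {E : Type*} [NormedAddCommGroup E] [InnerProductSpace ℂ E]
    [CompleteSpace E] (b : HilbertBasis κ ℂ E) {α β : ι → E}
    (h : Summable fun i => ‖α i‖ * ‖β i‖) :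
    Summable fun p : ι × κ => ⟪β p.1, b p.2⟫_ℂ * ⟪b p.2, α p.1⟫_ℂ := by
  refine Summable.of_norm ?_
  simp only [norm_mul]
  refine (summable_prod_of_nonneg fun p => by positivity).2
    ⟨fun i => (summable_norm_inner_mul_inner b (β i) (α i)).1, ?_⟩
  refine Summable.of_nonneg_of_le (fun i => tsum_nonneg fun e => by positivity) (fun i => ?_) h
  rw [mul_comm]
  exact (summable_norm_inner_mul_inner b (β i) (α i)).2

/-- The same double series is summed in both orders: over i first it gives ⟨e, C e⟩, over the basis
first it gives ⟨β_i, α_i⟩. So the trace can be computed from any nuclear expansion. -/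
theorem IsNuclearSum.hasSum_trace (h : IsNuclearSum α β C) :
    HasSum (fun i => ⟪β i, α i⟫_ℂ) (trace C) := by
  obtain ⟨b, hb⟩ := Classical.choose_spec (exists_hilbertBasis ℂ (Modes n))
  have hs := summable_of_norm_inner_mul_inner b h.1
  have h1 : ∀ e, HasSum (fun i => ⟪β i, b e⟫_ℂ * ⟪b e, α i⟫_ℂ) ⟪b e, C (b e)⟫_ℂ := fun e => by
    have h2 := (h.2.mapL ((ContinuousLinearMap.apply ℂ (Modes n) (b e)))).mapL (innerSL ℂ (b e))
    simpa [inner_smul_right] using h2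
  have h3 := hs.hasSum.prod_fiberwise (fun i => b.hasSum_inner_mul_inner (β i) (α i))
  have h4 := ((Equiv.prodComm ι _).symm.hasSum_iff.2 hs.hasSum).prod_fiberwise h1
  have h5 : trace C = ∑' e, ⟪b e, C (b e)⟫_ℂ := by
    rw [hb]; rfl
  rw [h5, h4.tsum_eq]
  exact h3

theorem IsNuclearSum.norm_trace_mul_le (h : IsNuclearSum α β C) (A : Modes n →L[ℂ] Modes n) :
    ‖trace (A * C)‖ ≤ ‖A‖ * ∑' i, ‖α i‖ * ‖β i‖ := by
  rw [← (h.mul_left A).hasSum_trace.tsum_eq]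
  rw [← tsum_mul_left]
  refine tsum_of_norm_bounded (h.1.mul_left _).hasSum fun i => ?_
  refine (norm_inner_le_norm _ _).trans ?_
  rw [mul_comm, ← mul_assoc]
  exact mul_le_mul_of_nonneg_right (A.le_opNorm _) (norm_nonneg _)

end NuclearSum

/-! ### Algebra of trace-class operators and properties of the trace. -/

section TraceClass

variable {n : ℕ} {C D : Modes n →L[ℂ] Modes n}

theorem IsTraceClass.exists_nuclearSum (h : IsTraceClass C) :
    ∃ α β : ℕ → Modes n, IsNuclearSum α β C := h

theorem IsTraceClass.mul_left (h : IsTraceClass C) (A : Modes n →L[ℂ] Modes n) :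
    IsTraceClass (A * C) := by
  obtain ⟨α, β, h⟩ := h.exists_nuclearSum
  exact (h.mul_left A).isTraceClass

theorem IsTraceClass.mul_right (h : IsTraceClass C) (A : Modes n →L[ℂ] Modes n) :
    IsTraceClass (C * A) := by
  obtain ⟨α, β, h⟩ := h.exists_nuclearSum
  exact (h.mul_right A).isTraceClass

theorem IsTraceClass.adjoint (h : IsTraceClass C) :
    IsTraceClass (ContinuousLinearMap.adjoint C) := by
  obtain ⟨α, β, h⟩ := h.exists_nuclearSum
  exact h.adjoint.isTraceClass

theorem IsTraceClass.smul (h : IsTraceClass C) (c : ℂ) : IsTraceClass (c • C) := by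
  obtain ⟨α, β, h⟩ := h.exists_nuclearSum
  exact (h.smul c).isTraceClass

theorem IsTraceClass.add (h : IsTraceClass C) (h' : IsTraceClass D) : IsTraceClass (C + D) := by
  obtain ⟨α, β, h⟩ := h.exists_nuclearSum
  obtain ⟨α', β', h'⟩ := h'.exists_nuclearSum
  exact (h.add h').isTraceClass

/-- Both traces equal ∑ ⟨β_i, A α_i⟩, with A moved across the inner product in one of them. -/
theorem IsTraceClass.trace_mul_comm (h : IsTraceClass C) (A : Modes n →L[ℂ] Modes n) :
    trace (A * C) = trace (C * A) := by
  obtain ⟨α, β, h⟩ := h.exists_nuclearSum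
  refine (h.mul_left A).hasSum_trace.unique ?_
  simpa only [ContinuousLinearMap.adjoint_inner_left] using (h.mul_right A).hasSum_trace

theorem IsTraceClass.trace_add (h : IsTraceClass C) (h' : IsTraceClass D) :
    trace (C + D) = trace C + trace D := by
  obtain ⟨α, β, h⟩ := h.exists_nuclearSum
  obtain ⟨α', β', h'⟩ := h'.exists_nuclearSum
  exact (h.add h').hasSum_trace.unique
    (HasSum.sum (f := fun i => ⟪Sum.elim β β' i, Sum.elim α α' i⟫_ℂ)
      h.hasSum_trace h'.hasSum_trace)

theorem trace_smul (c : ℂ) (C : Modes n →L[ℂ] Modes n) : trace (c • C) = c * trace C := by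
  simp only [trace, smul_apply, inner_smul_right, tsum_mul_left]

theorem IsTraceClass.trace_adjoint (h : IsTraceClass C) :
    trace (ContinuousLinearMap.adjoint C) = starRingEnd ℂ (trace C) := by
  obtain ⟨α, β, h⟩ := h.exists_nuclearSum
  refine h.adjoint.hasSum_trace.unique ?_
  have := h.hasSum_trace.map (starRingEnd ℂ) Complex.continuous_conj
  refine this.congr_fun fun i => ?_
  simp

/-- The functional `A ↦ Tr (A C)` is continuous in the operator norm. -/
theorem IsTraceClass.hasSum_trace_mul {κ : Type*} (h : IsTraceClass C)
    {A : κ → Modes n →L[ℂ] Modes n} {B : Modes n →L[ℂ] Modes n} (hA : HasSum A B) :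
    HasSum (fun k => trace (A k * C)) (trace (B * C)) := by
  obtain ⟨α, β, hC⟩ := h.exists_nuclearSum
  let L : (Modes n →L[ℂ] Modes n) →ₗ[ℂ] ℂ :=
    { toFun := fun A => trace (A * C)
      map_add' := fun A A' => by
        rw [add_mul, (h.mul_left A).trace_add (h.mul_left A')]
      map_smul' := fun c A => by
        rw [smul_mul_assoc, trace_smul, RingHom.id_apply, smul_eq_mul] }
  exact hA.mapL (L.mkContinuous (∑' i, ‖α i‖ * ‖β i‖) fun A => by
    rw [mul_comm]
    exact hC.norm_trace_mul_le A)

end TraceClass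

/-! ### The Weyl relations -/

section Weyl

variable {n d : ℕ}

theorem ell_pos (hd : 0 < d) : 0 < ell d := by
  have : (0 : ℝ) < d := by exact_mod_cast hd
  unfold ell; positivity

theorem ell_mul_ell (hd : 0 < d) : ell d * ell d = 2 * Real.pi / d := by
  unfold ell
  exact Real.mul_self_sqrt (by positivity)

/-- The phase `exp (i x)`. -/
def phase (x : ℝ) : ℂ := Complex.exp (Complex.I * (x : ℂ))

theorem phase_add (x y : ℝ) : phase (x + y) = phase x * phase y := by
  rw [phase, phase, phase, ← Complex.exp_add]; push_cast; ring_nf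

theorem phase_zero : phase 0 = 1 := by simp [phase]

theorem norm_phase (x : ℝ) : ‖phase x‖ = 1 := Complex.norm_exp_I_mul_ofReal x

theorem conj_phase (x : ℝ) : starRingEnd ℂ (phase x) = phase (-x) := by
  rw [phase, phase, ← Complex.exp_conj]; simp

theorem phase_int (k : ℤ) : phase (2 * Real.pi * k) = 1 := by
  rw [phase, Complex.exp_eq_one_iff]
  exact ⟨k, by push_cast; ring⟩

theorem phase_sum {ι : Type*} (s : Finset ι) (f : ι → ℝ) :
    phase (∑ i ∈ s, f i) = ∏ i ∈ s, phase (f i) := by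
  simp only [phase]
  push_cast
  rw [Finset.mul_sum, Complex.exp_sum]

@[fun_prop]
theorem continuous_phase : Continuous phase := by unfold phase; fun_prop

/-- Moving the modulation to the left of the translation costs exp(-iℓ² a_X ⬝ a_Z), and ℓ² = 2π/d
turns the symmetric phase π/d into -π/d. -/
theorem dispFun_eq (hd : 0 < d) (a : Phase n) (f : (Fin n → ℝ) → ℂ) (q : Fin n → ℝ) :
    dispFun d a f q = phase (ell d * (a.2 ⬝ᵥ q) - Real.pi * (a.1 ⬝ᵥ a.2) / d) *
      f (q - ell d • a.1) := by
  rw [dispFun_apply, ← mul_assoc]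
  congr 1
  change phase _ * phase _ = _
  rw [← phase_add]
  congr 1
  rw [dotProduct_sub, dotProduct_smul, mul_sub, smul_eq_mul, ← mul_assoc, ell_mul_ell hd,
    dotProduct_comm a.2 a.1]
  ring

theorem disp_mul_disp (hd : 0 < d) (a b : Phase n) :
    disp d a * disp d b = phase (-(Real.pi * symp a b / d)) • disp d (a + b) := by
  ext1 ψ
  apply Lp.ext
  rw [mul_apply_eq_comp, smul_apply]
  refine (coeFn_disp d a _).trans ((dispFun_congr d a (coeFn_disp d b ψ)).trans ?_)
  filter_upwards [Lp.coeFn_smul (phase (-(Real.pi * symp a b / d))) (disp d (a + b) ψ),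
    coeFn_disp d (a + b) ψ] with q h1 h2
  rw [h1, Pi.smul_apply, h2, dispFun_eq hd, dispFun_eq hd, dispFun_eq hd, smul_eq_mul,
    ← mul_assoc, ← mul_assoc, ← phase_add, ← phase_add]
  have h3 : q - ell d • a.1 - ell d • b.1 = q - ell d • (a + b).1 := by
    rw [Prod.fst_add, smul_add, sub_sub]
  rw [h3]
  congr 2
  simp only [symp, Prod.fst_add, Prod.snd_add, add_dotProduct, dotProduct_add, dotProduct_sub,
    dotProduct_smul, smul_eq_mul, mul_sub]
  rw [← mul_assoc, ell_mul_ell hd, dotProduct_comm b.2 a.1, dotProduct_comm a.2 b.1]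
  ring

theorem disp_zero : disp (n := n) d 0 = 1 := by
  ext1 ψ
  apply Lp.ext
  refine (coeFn_disp d 0 _).trans (Filter.Eventually.of_forall fun q => ?_)
  simp [dispFun_apply]

theorem symp_self (a : Phase n) : symp a a = 0 := by
  rw [symp, dotProduct_comm, sub_self]

theorem symp_neg_left (a b : Phase n) : symp (-a) b = -symp a b := by
  simp only [symp, Prod.fst_neg, Prod.snd_neg, neg_dotProduct]; ring

theorem symp_neg_right (a b : Phase n) : symp a (-b) = -symp a b := by
  simp only [symp, Prod.fst_neg, Prod.snd_neg, dotProduct_neg]; ring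

theorem symp_add_right (a b c : Phase n) : symp a (b + c) = symp a b + symp a c := by
  simp only [symp, Prod.fst_add, Prod.snd_add, dotProduct_add]; ring

theorem symp_add_left (a b c : Phase n) : symp (a + b) c = symp a c + symp b c := by
  simp only [symp, Prod.fst_add, Prod.snd_add, add_dotProduct]; ring

theorem symp_smul_right (r : ℝ) (a b : Phase n) : symp a (r • b) = r * symp a b := by
  simp only [symp, Prod.smul_fst, Prod.smul_snd, dotProduct_smul, smul_eq_mul]; ring

theorem symp_swap (a b : Phase n) : symp b a = -symp a b := by
  simp only [symp]; rw [dotProduct_comm b.1, dotProduct_comm b.2]; ring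

theorem disp_mul_disp_neg (hd : 0 < d) (a : Phase n) : disp d a * disp d (-a) = 1 := by
  rw [disp_mul_disp hd, symp_neg_right, symp_self, add_neg_cancel, disp_zero]
  simp [phase_zero]

theorem norm_disp_apply (a : Phase n) (ψ : Modes n) : ‖disp d a ψ‖ = ‖ψ‖ := by
  rw [Lp.norm_def, Lp.norm_def, eLpNorm_congr_ae (coeFn_disp d a ψ),
    eLpNorm_dispFun d a (Lp.memLp ψ).1]

/-- An isometry with right inverse T_{-a} has that inverse as its adjoint. -/
theorem adjoint_disp (hd : 0 < d) (a : Phase n) :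
    ContinuousLinearMap.adjoint (disp d a) = disp d (-a) := by
  symm
  rw [ContinuousLinearMap.eq_adjoint_iff]
  intro x y
  have h1 : ∀ u v : Modes n, ⟪disp d a u, disp d a v⟫_ℂ = ⟪u, v⟫_ℂ :=
    fun u v => LinearIsometry.inner_map_map (⟨(disp d a).toLinearMap, norm_disp_apply a⟩ :
      Modes n →ₗᵢ[ℂ] Modes n) u v
  rw [← h1, ← mul_apply_eq_comp, disp_mul_disp_neg hd]
  simp

theorem norm_disp_le (a : Phase n) : ‖disp (n := n) d a‖ ≤ 1 :=
  ContinuousLinearMap.opNorm_le_bound _ zero_le_one fun ψ => by rw [norm_disp_apply, one_mul]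

/-- Conjugation by a displacement multiplies displacements by a phase. -/
theorem disp_neg_mul_disp_mul_disp (hd : 0 < d) (a b : Phase n) :
    disp d (-b) * disp d a * disp d b = phase (-(2 * Real.pi * symp a b / d)) • disp d a := by
  rw [disp_mul_disp hd, smul_mul_assoc, disp_mul_disp hd, smul_smul, ← phase_add]
  congr 2
  · rw [symp_neg_left, symp_swap a b, symp_swap b (-b + a), symp_add_right, symp_neg_right,
      symp_self, symp_swap a b]
    ring
  · abel

end Weyl

/-! ### The Wigner function -/

section Wigner

variable {n d : ℕ}

theorem Lattice.toPhase_neg (a : Lattice n) : (-a).toPhase = -a.toPhase := by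
  ext <;> simp [Lattice.toPhase]

theorem Lattice.toPhase_add (a b : Lattice n) : (a + b).toPhase = a.toPhase + b.toPhase := by
  ext <;> simp [Lattice.toPhase]

theorem Lattice.toPhase_zero : (0 : Lattice n).toPhase = 0 := by
  ext <;> simp [Lattice.toPhase]

/-- The characteristic function `Tr (C T_a)` on the integer lattice. -/
def charFn (d : ℕ) (C : Modes n →L[ℂ] Modes n) (a : Lattice n) : ℂ :=
  trace (C * disp d a.toPhase)

/-- The sign `exp (i π a_X ⬝ a_Z)`. -/
def latticeSign (a : Lattice n) : ℂ := phase (Real.pi * (a.toPhase.1 ⬝ᵥ a.toPhase.2))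

theorem latticeSign_eq (a : Lattice n) :
    latticeSign a = phase (Real.pi * ((a.1 ⬝ᵥ a.2 : ℤ) : ℝ)) := by
  simp [latticeSign, Lattice.toPhase, dotProduct]

theorem latticeSign_mul_self (a : Lattice n) : latticeSign a * latticeSign a = 1 := by
  rw [latticeSign_eq, ← phase_add, ← phase_int (a.1 ⬝ᵥ a.2)]
  congr 1
  ring

theorem latticeSign_neg (a : Lattice n) : latticeSign (-a) = latticeSign a := by
  simp [latticeSign, Lattice.toPhase_neg]

/-- A number of modulus one whose square is one is real. -/
theorem conj_latticeSign (a : Lattice n) : starRingEnd ℂ (latticeSign a) = latticeSign a := by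
  have h := latticeSign_mul_self a
  have h2 : latticeSign a * starRingEnd ℂ (latticeSign a) = 1 := by
    rw [Complex.mul_conj, Complex.normSq_eq_norm_sq, latticeSign, norm_phase]; simp
  have h0 : latticeSign a ≠ 0 := left_ne_zero_of_mul_eq_one h
  exact mul_left_cancel₀ h0 (h2.trans h.symm)

theorem norm_latticeSign (a : Lattice n) : ‖latticeSign a‖ = 1 := norm_phase _

theorem wigner_eq (C : Modes n →L[ℂ] Modes n) (η : Phase n) :
    wigner d C η = 1 / (2 * (Real.pi : ℂ)) ^ n *
      ∑' a : Lattice n, phase (ell d * symp a.toPhase η) * latticeSign a * charFn d C a := by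
  simp only [wigner, Complex.exp_add]
  rfl

theorem HasWigner.summable_term {C : Modes n →L[ℂ] Modes n} (hC : HasWigner d C) (η : Phase n) :
    Summable fun a : Lattice n =>
      phase (ell d * symp a.toPhase η) * latticeSign a * charFn d C a := by
  refine Summable.of_norm (hC.2.congr fun a => ?_)
  rw [norm_mul, norm_mul, norm_phase, norm_latticeSign, one_mul, one_mul, charFn]

theorem HasWigner.add {C D : Modes n →L[ℂ] Modes n} (hC : HasWigner d C) (hD : HasWigner d D) :
    HasWigner d (C + D) ∧ ∀ η, wigner d (C + D) η = wigner d C η + wigner d D η := by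
  have h : ∀ a, charFn d (C + D) a = charFn d C a + charFn d D a := fun a => by
    rw [charFn, add_mul, (hC.1.mul_right _).trace_add (hD.1.mul_right _)]; rfl
  refine ⟨⟨hC.1.add hD.1, ?_⟩, fun η => ?_⟩
  · refine Summable.of_nonneg_of_le (fun _ => norm_nonneg _) (fun a => ?_) (hC.2.add hD.2)
    exact (congrArg norm (h a)).trans_le (norm_add_le _ _)
  · rw [wigner_eq, wigner_eq, wigner_eq, ← mul_add,
      ← (hC.summable_term η).tsum_add (hD.summable_term η)]
    simp only [h, mul_add]

theorem HasWigner.smul {C : Modes n →L[ℂ] Modes n} (hC : HasWigner d C) (c : ℂ) :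
    HasWigner d (c • C) ∧ ∀ η, wigner d (c • C) η = c * wigner d C η := by
  have h : ∀ a, charFn d (c • C) a = c * charFn d C a := fun a => by
    rw [charFn, smul_mul_assoc, trace_smul]; rfl
  refine ⟨⟨hC.1.smul c, ?_⟩, fun η => ?_⟩
  · refine (hC.2.mul_left ‖c‖).congr fun a => ?_
    rw [← norm_mul]
    exact (congrArg norm (h a)).symm
  · rw [wigner_eq, wigner_eq, mul_left_comm]
    simp only [h, mul_left_comm _ c, tsum_mul_left]

/-- The characteristic function of the adjoint at a is the conjugate of the original one at -a. The
substitution a ↦ -a then conjugates the whole series, the sign being real and even. -/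
theorem HasWigner.adjoint (hd : 0 < d) {C : Modes n →L[ℂ] Modes n} (hC : HasWigner d C) :
    HasWigner d (ContinuousLinearMap.adjoint C) ∧
      ∀ η, wigner d (ContinuousLinearMap.adjoint C) η = starRingEnd ℂ (wigner d C η) := by
  have h : ∀ a, charFn d (ContinuousLinearMap.adjoint C) a = starRingEnd ℂ (charFn d C (-a)) :=
    fun a => by
      rw [charFn, charFn, ← (hC.1.mul_right _).trace_adjoint, Lattice.toPhase_neg,
        ContinuousLinearMap.mul_def C, ContinuousLinearMap.adjoint_comp,
        adjoint_disp hd, neg_neg, ← ContinuousLinearMap.mul_def, hC.1.adjoint.trace_mul_comm]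
  refine ⟨⟨hC.1.adjoint, ?_⟩, fun η => ?_⟩
  · refine ((Equiv.neg (Lattice n)).summable_iff.2 hC.2).congr fun a => ?_
    exact ((congrArg norm (h a)).trans (RCLike.norm_conj _)).symm
  · rw [wigner_eq, wigner_eq, map_mul, Complex.conj_tsum, ← (Equiv.neg (Lattice n)).tsum_eq]
    congr 1
    · simp [Complex.conj_ofNat]
    · refine tsum_congr fun a => ?_
      rw [Equiv.neg_apply, h, neg_neg, map_mul, map_mul, conj_phase, conj_latticeSign,
        latticeSign_neg, Lattice.toPhase_neg, symp_neg_left, mul_neg]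

/-- Cyclicity moves the conjugation onto T_a, where it yields the phase exp(-2πi[a, b]/d). Since ℓ²
= 2π/d this equals exp(-iℓ[a, ℓb]), a translation of η by ℓb. -/
theorem HasWigner.conj_disp (hd : 0 < d) {C : Modes n →L[ℂ] Modes n} (hC : HasWigner d C)
    (b : Phase n) :
    HasWigner d (disp d b * C * ContinuousLinearMap.adjoint (disp d b)) ∧
      ∀ η, wigner d (disp d b * C * ContinuousLinearMap.adjoint (disp d b)) η =
        wigner d C (η - ell d • b) := by
  have h : ∀ a, charFn d (disp d b * C * ContinuousLinearMap.adjoint (disp d b)) a =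
      phase (-(2 * Real.pi * symp a.toPhase b / d)) * charFn d C a := fun a => by
    rw [charFn, charFn, adjoint_disp hd, mul_assoc, mul_assoc,
      (hC.1.mul_right _).trace_mul_comm, mul_assoc, disp_neg_mul_disp_mul_disp hd,
      mul_smul_comm, trace_smul]
  refine ⟨⟨(hC.1.mul_left _).mul_right _, ?_⟩, fun η => ?_⟩
  · refine hC.2.congr fun a => ?_
    refine ((congrArg norm (h a)).trans ?_).symm
    rw [norm_mul, norm_phase, one_mul, charFn]
  · rw [wigner_eq, wigner_eq]
    congr 1
    refine tsum_congr fun a => ?_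
    rw [h, sub_eq_add_neg, symp_add_right, symp_neg_right, symp_smul_right, mul_add, phase_add,
      mul_neg, ← mul_assoc (ell d), ell_mul_ell hd]
    ring_nf

end Wigner

/-! ### Integrals of characters over boxes -/

/-- The cube `[0, r)^ι`. -/
def cube (ι : Type*) (r : ℝ) : Set (ι → ℝ) := Set.univ.pi fun _ => Set.Ico 0 r

theorem measurableSet_cube (ι : Type*) [Countable ι] (r : ℝ) : MeasurableSet (cube ι r) :=
  MeasurableSet.univ_pi fun _ => measurableSet_Ico

theorem volume_cube (ι : Type*) [Fintype ι] (r : ℝ) :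
    volume (cube ι r) = ENNReal.ofReal r ^ Fintype.card ι := by
  rw [cube, Real.volume_pi_Ico]
  simp [Finset.card_univ]

theorem volume_cube_ne_top (ι : Type*) [Fintype ι] (r : ℝ) : volume (cube ι r) ≠ ⊤ := by
  rw [volume_cube]; exact ENNReal.pow_ne_top ENNReal.ofReal_ne_top

theorem box_eq (n : ℕ) (r : ℝ) : box n r = cube (Fin n) r ×ˢ cube (Fin n) r := rfl

theorem measurableSet_box (n : ℕ) (r : ℝ) : MeasurableSet (box n r) :=
  (measurableSet_cube _ r).prod (measurableSet_cube _ r)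

theorem volume_box_ne_top (n : ℕ) (r : ℝ) : volume (box n r) ≠ ⊤ := by
  rw [box_eq, Measure.volume_eq_prod, Measure.prod_prod]
  exact ENNReal.mul_ne_top (volume_cube_ne_top _ _) (volume_cube_ne_top _ _)

theorem setIntegral_Ico_phase {c r : ℝ} (hcr : c * r = 2 * Real.pi) (hr : 0 < r) (m : ℤ) :
    ∫ x in Set.Ico 0 r, phase (c * (m * x)) = if m = 0 then (r : ℂ) else 0 := by
  rw [integral_Ico_eq_integral_Ioc, ← intervalIntegral.integral_of_le hr.le]
  split_ifs with h
  · simp [h, phase_zero]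
  · have hc : c ≠ 0 := by rintro rfl; have := Real.pi_pos; linarith
    have hne : Complex.I * c * m ≠ 0 := by simp [hc, h]
    have h1 : ∀ x : ℝ, phase (c * (m * x)) = Complex.exp (Complex.I * c * m * x) := fun x => by
      rw [phase]; push_cast; ring_nf
    simp only [h1]
    rw [integral_exp_mul_complex hne, ← h1, ← h1, mul_zero, mul_zero, phase_zero,
      show c * (m * r) = 2 * Real.pi * m by rw [← hcr]; ring, phase_int, sub_self, zero_div]

theorem setIntegral_cube_prod {ι : Type*} [Fintype ι] (r : ℝ) (f : ι → ℝ → ℂ) :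
    ∫ x in cube ι r, ∏ i, f i (x i) = ∏ i, ∫ x in Set.Ico 0 r, f i x := by
  rw [cube, volume_pi, Measure.restrict_pi_pi, integral_fintype_prod_eq_prod]

theorem setIntegral_cube_phase {ι : Type*} [Fintype ι] {c r : ℝ} (hcr : c * r = 2 * Real.pi)
    (hr : 0 < r) (m : ι → ℤ) :
    ∫ x in cube ι r, phase (c * ((fun i => (m i : ℝ)) ⬝ᵥ x)) =
      if m = 0 then (r : ℂ) ^ Fintype.card ι else 0 := by
  simp only [dotProduct, Finset.mul_sum, phase_sum]
  rw [setIntegral_cube_prod r fun i x => phase (c * (m i * x))]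
  simp only [setIntegral_Ico_phase hcr hr]
  split_ifs with h
  · simp [h, Finset.card_univ]
  · obtain ⟨i, hi⟩ := Function.ne_iff.1 h
    exact Finset.prod_eq_zero (Finset.mem_univ i) (if_neg hi)

theorem setIntegral_box_phase {n : ℕ} {c r : ℝ} (hcr : c * r = 2 * Real.pi) (hr : 0 < r)
    (a : Lattice n) :
    ∫ η in box n r, phase (c * symp a.toPhase η) = if a = 0 then (r : ℂ) ^ (2 * n) else 0 := by
  have h1 : ∀ η : Phase n, phase (c * symp a.toPhase η) =
      phase (c * ((fun i => ((-a.2) i : ℝ)) ⬝ᵥ η.1)) *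
        phase (c * ((fun i => (a.1 i : ℝ)) ⬝ᵥ η.2)) := fun η => by
    rw [← phase_add]
    congr 1
    simp only [symp, Lattice.toPhase, dotProduct, Pi.neg_apply, neg_mul, Int.cast_neg,
      Finset.sum_neg_distrib]
    ring
  simp only [h1]
  have h2 := setIntegral_prod_mul (μ := (volume : Measure (Fin n → ℝ)))
    (ν := (volume : Measure (Fin n → ℝ)))
    (fun x => phase (c * ((fun i => ((-a.2) i : ℝ)) ⬝ᵥ x)))
    (fun x => phase (c * ((fun i => (a.1 i : ℝ)) ⬝ᵥ x))) (cube (Fin n) r) (cube (Fin n) r)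
  rw [← Measure.volume_eq_prod, ← box_eq] at h2
  have h3 := setIntegral_cube_phase hcr hr (-a.2)
  rw [h2, setIntegral_cube_phase hcr hr a.1, h3]
  by_cases h : a = 0
  · simp [h, two_mul, pow_add]
  · rw [if_neg h]
    rw [Prod.ext_iff, not_and_or] at h
    rcases h with h | h
    · rw [if_neg (show ¬ a.1 = 0 from h), mul_zero]
    · rw [if_neg (by simpa using h), zero_mul]

/-! ### Orthogonality of characters on the phase-space torus, standardization, and the integral of a
product. -/

section Torus

variable {n d : ℕ}

theorem ell_mul_period (hd : 0 < d) : ell d * (d * ell d) = 2 * Real.pi := by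
  have : (d : ℝ) ≠ 0 := by positivity
  rw [mul_left_comm, ell_mul_ell hd]; field_simp

instance : IsFiniteMeasure (torusMeasure n d) := by
  have : IsFiniteMeasure (volume.restrict (box n (d * ell d))) :=
    isFiniteMeasure_restrict.2 (volume_box_ne_top _ _)
  unfold torusMeasure
  exact Measure.smul_finite _ ENNReal.ofReal_ne_top

theorem integral_torus_phase (hd : 0 < d) (a : Lattice n) :
    ∫ η, phase (ell d * symp a.toPhase η) ∂torusMeasure n d =
      if a = 0 then (2 * (Real.pi : ℂ)) ^ n else 0 := by
  have hd' : (0 : ℝ) < d := by exact_mod_cast hd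
  rw [torusMeasure, integral_smul_measure,
    setIntegral_box_phase (ell_mul_period hd) (mul_pos hd' (ell_pos hd)),
    ENNReal.toReal_ofReal (by positivity)]
  split_ifs
  · rw [Complex.real_smul, ← Complex.ofReal_ofNat 2]
    norm_cast
    rw [← ell_mul_period hd]
    push_cast
    field_simp
    ring
  · simp

@[fun_prop]
theorem continuous_symp (a : Phase n) : Continuous (symp a) := by
  unfold symp dotProduct
  fun_prop

/-- The index map g serves two uses: the identity for a single Wigner function, and (a, b) ↦ a + b
for a product of two. -/
theorem integrable_phase_tsum {ι : Type*} (g : ι → Lattice n) {s : ι → ℂ} (hs : Summable s) :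
    Integrable (fun η => ∑' i, phase (ell d * symp (g i).toPhase η) * s i) (torusMeasure n d) := by
  have hb : ∀ i η, ‖phase (ell d * symp (g i).toPhase η) * s i‖ ≤ ‖s i‖ := fun i η => by
    rw [norm_mul, norm_phase, one_mul]
  refine Integrable.of_bound (C := ∑' i, ‖s i‖) ?_ (Filter.Eventually.of_forall fun η => ?_)
  · exact (continuous_tsum (fun i => by fun_prop) hs.norm hb).aestronglyMeasurable
  · exact tsum_of_norm_bounded hs.norm.hasSum fun i => hb i η

theorem integral_phase_tsum (hd : 0 < d) {ι : Type*} [Countable ι] (g : ι → Lattice n) {s : ι → ℂ}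
    (hs : Summable s) :
    ∫ η, ∑' i, phase (ell d * symp (g i).toPhase η) * s i ∂torusMeasure n d =
      (2 * (Real.pi : ℂ)) ^ n * ∑' i, if g i = 0 then s i else 0 := by
  rw [← integral_tsum_of_summable_integral_norm, ← tsum_mul_left]
  · refine tsum_congr fun i => ?_
    rw [integral_mul_const, integral_torus_phase hd]
    split_ifs <;> simp
  · intro i
    refine Integrable.of_bound (C := ‖s i‖) (Continuous.aestronglyMeasurable (by fun_prop))
      (Filter.Eventually.of_forall fun η => ?_)
    rw [norm_mul, norm_phase, one_mul]
  · simp only [norm_mul, norm_phase, one_mul, integral_const]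
    exact hs.norm.const_smul _

theorem HasWigner.summable_sign_mul {C : Modes n →L[ℂ] Modes n} (hC : HasWigner d C) :
    Summable fun a => ‖latticeSign a * charFn d C a‖ := by
  refine hC.2.congr fun a => ?_
  rw [norm_mul, norm_latticeSign, one_mul, charFn]

theorem HasWigner.integral_wigner (hd : 0 < d) {C : Modes n →L[ℂ] Modes n} (hC : HasWigner d C) :
    Integrable (wigner d C) (torusMeasure n d) ∧
      ∫ η, wigner d C η ∂torusMeasure n d = trace C := by
  have hs := hC.summable_sign_mul.of_norm
  have hW : wigner d C = fun η => 1 / (2 * (Real.pi : ℂ)) ^ n *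
      ∑' a : Lattice n, phase (ell d * symp a.toPhase η) * (latticeSign a * charFn d C a) := by
    funext η
    simp only [wigner_eq, mul_assoc]
  have hpi : (2 * (Real.pi : ℂ)) ^ n ≠ 0 := by simp [Real.pi_ne_zero]
  rw [hW]
  refine ⟨(integrable_phase_tsum (fun a => a) hs).const_mul _, ?_⟩
  rw [integral_const_mul, integral_phase_tsum hd (fun a => a) hs, ← mul_assoc,
    one_div_mul_cancel hpi, one_mul, tsum_eq_single 0 fun a ha => if_neg ha, if_pos rfl, charFn,
    Lattice.toPhase_zero, disp_zero, mul_one, latticeSign, Lattice.toPhase_zero]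
  simp [phase_zero]

theorem tsum_ite_add_eq_zero {G : Type*} [AddCommGroup G] [DecidableEq G] {s : G × G → ℂ}
    (hs : Summable s) : ∑' p : G × G, (if p.1 + p.2 = 0 then s p else 0) = ∑' a, s (a, -a) := by
  have hs' : Summable fun p : G × G => if p.1 + p.2 = 0 then s p else 0 := by
    refine Summable.of_norm_bounded hs.norm fun p => ?_
    split_ifs <;> simp
  rw [hs'.tsum_prod]
  refine tsum_congr fun a => ?_
  rw [tsum_eq_single (-a) fun b hb => if_neg fun h => hb (eq_neg_of_add_eq_zero_right h),
    if_pos (add_neg_cancel a)]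

theorem HasWigner.wigner_mul {C D : Modes n →L[ℂ] Modes n}
    (hC : HasWigner d C) (hD : HasWigner d D) (η : Phase n) :
    wigner d C η * wigner d D η =
      (1 / (2 * (Real.pi : ℂ)) ^ n * (1 / (2 * (Real.pi : ℂ)) ^ n)) *
        ∑' p : Lattice n × Lattice n, phase (ell d * symp (p.1 + p.2 : Lattice n).toPhase η) *
          (latticeSign p.1 * charFn d C p.1 * (latticeSign p.2 * charFn d D p.2)) := by
  rw [wigner_eq, wigner_eq, mul_mul_mul_comm,
    tsum_mul_tsum_of_summable_norm (hC.summable_term η).norm (hD.summable_term η).norm]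
  congr 1
  refine tsum_congr fun p => ?_
  rw [Lattice.toPhase_add, symp_add_left, mul_add, phase_add]
  ring

/-- Only pairs (a, b) with a + b = 0 survive integration. Their two signs multiply to one, and the
total mass (2π)ⁿ cancels one of the two prefactors. -/
theorem HasWigner.integral_wigner_mul (hd : 0 < d) {C D : Modes n →L[ℂ] Modes n}
    (hC : HasWigner d C) (hD : HasWigner d D) :
    Integrable (fun η => wigner d C η * wigner d D η) (torusMeasure n d) ∧
      ∫ η, wigner d C η * wigner d D η ∂torusMeasure n d =
        1 / (2 * (Real.pi : ℂ)) ^ n * ∑' a, charFn d C a * charFn d D (-a) := by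
  have hs := summable_mul_of_summable_norm hC.summable_sign_mul hD.summable_sign_mul
  have hpi : (2 * (Real.pi : ℂ)) ^ n ≠ 0 := by simp [Real.pi_ne_zero]
  simp only [hC.wigner_mul hD]
  refine ⟨(integrable_phase_tsum (fun p : Lattice n × Lattice n => p.1 + p.2) hs).const_mul _, ?_⟩
  rw [integral_const_mul, integral_phase_tsum hd (fun p : Lattice n × Lattice n => p.1 + p.2) hs,
    tsum_ite_add_eq_zero hs, mul_assoc, ← mul_assoc (1 / (2 * (Real.pi : ℂ)) ^ n) (_ ^ n),
    one_div_mul_cancel hpi, one_mul]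
  congr 1
  refine tsum_congr fun a => ?_
  rw [latticeSign_neg, mul_mul_mul_comm, latticeSign_mul_self, one_mul]

end Torus

/-! ### The decomposition of a cube into cells -/

/-- The cube `r (j + [0, 1)ⁿ)`. -/
def cell {n d : ℕ} (r : ℝ) (j : Fin n → Fin d) : Set (Fin n → ℝ) :=
  Set.univ.pi fun k => Set.Ico (r * ((j k : ℕ) : ℝ)) (r * (((j k : ℕ) : ℝ) + 1))

section Cells

variable {n d : ℕ}

theorem measurableSet_cell (r : ℝ) (j : Fin n → Fin d) : MeasurableSet (cell r j) :=
  MeasurableSet.univ_pi fun _ => measurableSet_Ico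

theorem eq_of_mem_cell {r : ℝ} (hr : 0 < r) {x y : ℕ} {t : ℝ}
    (hx : t ∈ Set.Ico (r * (x : ℝ)) (r * ((x : ℝ) + 1)))
    (hy : t ∈ Set.Ico (r * (y : ℝ)) (r * ((y : ℝ) + 1))) : x = y := by
  have h1 : (x : ℝ) < y + 1 := lt_of_mul_lt_mul_left (hx.1.trans_lt hy.2) hr.le
  have h2 : (y : ℝ) < x + 1 := lt_of_mul_lt_mul_left (hy.1.trans_lt hx.2) hr.le
  norm_cast at h1 h2
  omega

theorem iUnion_cell {r : ℝ} (hr : 0 < r) :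
    ⋃ j : Fin n → Fin d, cell r j = cube (Fin n) (d * r) := by
  ext x
  simp only [Set.mem_iUnion, cell, cube, Set.mem_univ_pi]
  constructor
  · rintro ⟨j, hj⟩ k
    have h1 : ((j k : ℕ) : ℝ) + 1 ≤ d := by exact_mod_cast (j k).2
    refine ⟨le_trans (by positivity) (hj k).1, (hj k).2.trans_le ?_⟩
    rw [mul_comm (d : ℝ)]
    exact mul_le_mul_of_nonneg_left h1 hr.le
  · intro hx
    have hlt : ∀ k, ⌊x k / r⌋₊ < d := fun k => by
      rw [Nat.floor_lt (div_nonneg (hx k).1 hr.le), div_lt_iff₀ hr]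
      exact (hx k).2
    refine ⟨fun k => ⟨⌊x k / r⌋₊, hlt k⟩, fun k => ⟨?_, ?_⟩⟩
    · rw [mul_comm, ← le_div_iff₀ hr]
      exact Nat.floor_le (div_nonneg (hx k).1 hr.le)
    · rw [mul_comm, ← div_lt_iff₀ hr]
      exact Nat.lt_floor_add_one _

theorem sum_setIntegral_cell {r : ℝ} (hr : 0 < r) {f : (Fin n → ℝ) → ℂ}
    (hf : IntegrableOn f (cube (Fin n) (d * r))) :
    ∑ j : Fin n → Fin d, ∫ x in cell r j, f x = ∫ x in cube (Fin n) (d * r), f x := by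
  rw [← iUnion_cell hr, integral_iUnion_fintype (fun j => measurableSet_cell r j)]
  · intro i j hij
    refine Set.disjoint_left.2 fun x hi hj => hij ?_
    ext k
    exact eq_of_mem_cell hr (hi k trivial) (hj k trivial)
  · exact fun j => hf.mono_set (by rw [← iUnion_cell hr]; exact Set.subset_iUnion _ j)

/-- A translation by a nonzero vector of ℓℤⁿ moves the cube off itself; without translation only the
character is integrated over the cube. -/
theorem inner_cellVec_disp (hd : 0 < d) (a : Lattice n) (j : Fin n → Fin d) :
    ⟪cellVec d j, disp d a.toPhase (cellVec d j)⟫_ℂ =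
      if a.1 = 0 then (((ell d)⁻¹ ^ n : ℝ) : ℂ) *
        ∫ q in cell (ell d) j, phase (ell d * ((fun i => (a.2 i : ℝ)) ⬝ᵥ q)) else 0 := by
  have hl := ell_pos hd
  have hmem : ∀ q ∈ cell (ell d) j, a.1 ≠ 0 → q - ell d • a.toPhase.1 ∉ cell (ell d) j := by
    intro q hq ha hq'
    obtain ⟨k, hk⟩ := Function.ne_iff.1 ha
    have h1 := hq k trivial
    have h2 := hq' k trivial
    simp only [Pi.sub_apply, Pi.smul_apply, Lattice.toPhase, smul_eq_mul, Set.mem_Ico] at h1 h2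
    have h3 : (a.1 k : ℝ) < 1 := lt_of_mul_lt_mul_left (by linarith) hl.le
    have h4 : (-1 : ℝ) < a.1 k := lt_of_mul_lt_mul_left (by linarith) hl.le
    have h3' : a.1 k < 1 := by exact_mod_cast h3
    have h4' : -1 < a.1 k := by exact_mod_cast h4
    exact hk (by simp only [Pi.zero_apply]; omega)
  set κ : ℂ := (((Real.sqrt (ell d))⁻¹ ^ n : ℝ) : ℂ) with hκ
  rw [cellVec, L2.inner_indicatorConstLp_eq_inner_setIntegral]
  have h1 : ∫ q in posCell d j, (disp d a.toPhase (cellVec d j)) q =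
      ∫ q in cell (ell d) j, if a.1 = 0 then
        κ * phase (ell d * ((fun i => (a.2 i : ℝ)) ⬝ᵥ q)) else 0 := by
    refine setIntegral_congr_ae (measurableSet_cell _ j) ?_
    filter_upwards [coeFn_disp d a.toPhase (cellVec d j),
      dispFun_congr d a.toPhase (indicatorConstLp_coeFn (p := 2) (hs := measurableSet_posCell d j)
        (hμs := volume_posCell_ne_top d j) (c := κ))] with q h2 h3 hq
    rw [h2]
    refine Eq.trans h3 ?_
    rw [dispFun_eq hd]
    split_ifs with ha
    · have h4 : a.toPhase.1 = 0 := by ext k; simp [Lattice.toPhase, ha]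
      rw [h4, smul_zero, sub_zero, Set.indicator_of_mem (show q ∈ posCell d j from hq)]
      simp [mul_comm κ, Lattice.toPhase]
    · rw [Set.indicator_of_notMem (s := posCell d j) (hmem q hq ha), mul_zero]
  change inner ℂ κ (∫ q in posCell d j, (disp d a.toPhase (cellVec d j)) q) = _
  rw [h1]
  split_ifs
  · rw [integral_const_mul, RCLike.inner_apply, hκ, Complex.conj_ofReal, mul_right_comm]
    congr 1
    rw [← Complex.ofReal_mul, ← mul_pow, ← mul_inv, Real.mul_self_sqrt hl.le]
  · simp

/-- The dⁿ cubes tile [0, dℓ)ⁿ, a full period of exp(iℓ a_Z ⬝ q), so only a = 0 contributes, with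
value (2π/d)ⁿ ℓ⁻ⁿ (dℓ)ⁿ = (2π)ⁿ. -/
theorem cellTrace_disp (hd : 0 < d) (a : Lattice n) :
    cellTrace d (disp d a.toPhase) = if a = 0 then (2 * (Real.pi : ℂ)) ^ n else 0 := by
  have hd' : (0 : ℝ) < d := by exact_mod_cast hd
  have hl := ell_pos hd
  simp only [cellTrace, inner_cellVec_disp hd]
  by_cases h1 : a.1 = 0
  · simp only [h1, if_true]
    rw [← Finset.mul_sum, sum_setIntegral_cell hl, setIntegral_cube_phase (ell_mul_period hd)
      (mul_pos hd' hl)]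
    · by_cases h2 : a.2 = 0
      · rw [if_pos h2, if_pos (Prod.ext h1 h2), Fintype.card_fin]
        norm_cast
        rw [← mul_pow, ← mul_pow]
        congr 1
        field_simp
      · rw [if_neg h2, if_neg fun h => h2 (by rw [h]; rfl), mul_zero, mul_zero]
    · have : IsFiniteMeasure (volume.restrict (cube (Fin n) (d * ell d))) :=
        isFiniteMeasure_restrict.2 (volume_cube_ne_top _ _)
      refine Integrable.of_bound (C := 1) (Continuous.aestronglyMeasurable ?_)
        (Filter.Eventually.of_forall fun q => (norm_phase _).le)
      unfold dotProduct
      fun_prop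
  · simp [h1, show a ≠ 0 from fun h => h1 (by rw [h]; rfl)]

end Cells

/-! ### Parseval's identity on the unit cube -/

section Parseval

-- The normalized Haar measure, so that the torus has mass one like the unit cube.
local instance : MeasureSpace UnitAddCircle := ⟨AddCircle.haarAddCircle⟩

local instance : Measure.IsAddHaarMeasure (volume : Measure UnitAddCircle) :=
  inferInstanceAs (Measure.IsAddHaarMeasure AddCircle.haarAddCircle)

local instance : IsProbabilityMeasure (volume : Measure UnitAddCircle) :=
  inferInstanceAs (IsProbabilityMeasure AddCircle.haarAddCircle)

variable {ι : Type*} [Fintype ι]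

/-- The coordinates of a point of the torus in the cube `(0, 1]^ι`. -/
def torusCoord (ι : Type*) (y : UnitAddTorus ι) : ι → ℝ :=
  (UnitAddTorus.measurableEquivPiIoc (fun _ : ι => (0 : ℝ)) y).1

theorem restrict_Ioc_eq_restrict_cube :
    (volume : Measure (ι → ℝ)).restrict {x | ∀ i, x i ∈ Set.Ioc (0 : ℝ) (0 + 1)} =
      volume.restrict (cube ι 1) := by
  refine Measure.restrict_congr_set ?_
  have h1 : {x : ι → ℝ | ∀ i, x i ∈ Set.Ioc (0 : ℝ) (0 + 1)} =
      Set.univ.pi fun i => Set.Ioc ((0 : ι → ℝ) i) ((1 : ι → ℝ) i) := by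
    ext x; simp
  rw [h1]
  exact (Measure.univ_pi_Ioc_ae_eq_Icc (μ := fun _ : ι => (volume : Measure ℝ))).trans
    (Measure.univ_pi_Ico_ae_eq_Icc (μ := fun _ : ι => (volume : Measure ℝ))).symm

theorem measurePreserving_torusCoord :
    MeasurePreserving (torusCoord ι) volume (volume.restrict (cube ι 1)) := by
  rw [← restrict_Ioc_eq_restrict_cube]
  exact (measurePreserving_subtype_coe
    (MeasurableSet.univ_pi' fun _ => measurableSet_Ioc)).comp
    (UnitAddTorus.measurePreserving_equivPiIoc fun _ : ι => (0 : ℝ))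

theorem measurableEmbedding_torusCoord : MeasurableEmbedding (torusCoord ι) :=
  (MeasurableEmbedding.subtype_coe (MeasurableSet.univ_pi' fun _ => measurableSet_Ioc)).comp
    (UnitAddTorus.measurableEquivPiIoc fun _ : ι => (0 : ℝ)).measurableEmbedding

theorem mFourier_eq_phase (m : ι → ℤ) (y : UnitAddTorus ι) :
    UnitAddTorus.mFourier m y =
      phase (2 * Real.pi * ((fun i => (m i : ℝ)) ⬝ᵥ torusCoord ι y)) := by
  have h : ∀ i, y i = ((torusCoord ι y i : ℝ) : UnitAddCircle) := fun i =>
    (congrFun ((UnitAddTorus.measurableEquivPiIoc fun _ : ι => (0 : ℝ)).symm_apply_apply y) i).symm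
  simp only [UnitAddTorus.mFourier, ContinuousMap.coe_mk, dotProduct, Finset.mul_sum, phase_sum]
  refine Finset.prod_congr rfl fun i _ => ?_
  rw [h i, fourier_coe_apply, phase]
  push_cast
  congr 1
  ring

/-- Parseval for the Fourier basis of the torus, transported through the measure-preserving
coordinates `torusCoord`. -/
theorem hasSum_parseval_cube {f g : (ι → ℝ) → ℂ} (hf : MemLp f 2 (volume.restrict (cube ι 1)))
    (hg : MemLp g 2 (volume.restrict (cube ι 1))) :
    HasSum (fun m : ι → ℤ =>
      (∫ x in cube ι 1, phase (2 * Real.pi * ((fun i => (m i : ℝ)) ⬝ᵥ x)) * f x) *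
        starRingEnd ℂ (∫ x in cube ι 1, phase (2 * Real.pi * ((fun i => (m i : ℝ)) ⬝ᵥ x)) * g x))
      (∫ x in cube ι 1, f x * starRingEnd ℂ (g x)) := by
  have hF := hf.comp_measurePreserving (measurePreserving_torusCoord (ι := ι))
  have hG := hg.comp_measurePreserving (measurePreserving_torusCoord (ι := ι))
  have hcoef : ∀ (u : (ι → ℝ) → ℂ) (hU : MemLp (u ∘ torusCoord ι) 2 volume) (m : ι → ℤ),
      UnitAddTorus.mFourierCoeff (hU.toLp _) m =
        ∫ x in cube ι 1, phase (2 * Real.pi * ((fun i => ((-m) i : ℝ)) ⬝ᵥ x)) * u x := by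
    intro u hU m
    rw [← measurePreserving_torusCoord.integral_comp measurableEmbedding_torusCoord]
    refine integral_congr_ae ?_
    filter_upwards [hU.coeFn_toLp] with y hy
    rw [hy, mFourier_eq_phase]
    rfl
  have h := UnitAddTorus.hasSum_prod_mFourierCoeff (hG.toLp _) (hF.toLp _)
  -- The m-th Fourier coefficient integrates against the character of -m, hence the change of sign
  -- of the index.
  rw [← (Equiv.neg (ι → ℤ)).hasSum_iff] at h
  have hint : ∫ t, starRingEnd ℂ (hG.toLp _ t) * hF.toLp _ t =
      ∫ x in cube ι 1, f x * starRingEnd ℂ (g x) := by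
    rw [← measurePreserving_torusCoord.integral_comp measurableEmbedding_torusCoord]
    refine integral_congr_ae ?_
    filter_upwards [hF.coeFn_toLp, hG.coeFn_toLp] with y h1 h2
    rw [h1, h2, mul_comm]
    rfl
  rw [hint] at h
  refine h.congr_fun fun m => ?_
  simp only [Function.comp_apply, Equiv.neg_apply]
  rw [hcoef, hcoef, neg_neg, mul_comm]

end Parseval

/-- The box is the unit cube over the index set `Fin n ⊕ Fin n`. -/
theorem hasSum_parseval_box {n : ℕ} {f g : Phase n → ℂ}
    (hf : MemLp f 2 (volume.restrict (box n 1))) (hg : MemLp g 2 (volume.restrict (box n 1))) :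
    HasSum (fun a : Lattice n =>
      (∫ x in box n 1, phase (2 * Real.pi *
        (a.toPhase.1 ⬝ᵥ x.1 + a.toPhase.2 ⬝ᵥ x.2)) * f x) *
      starRingEnd ℂ (∫ x in box n 1, phase (2 * Real.pi *
        (a.toPhase.1 ⬝ᵥ x.1 + a.toPhase.2 ⬝ᵥ x.2)) * g x))
      (∫ x in box n 1, f x * starRingEnd ℂ (g x)) := by
  let e := MeasurableEquiv.sumPiEquivProdPi fun _ : Fin n ⊕ Fin n => ℝ
  have he : MeasurePreserving e volume volume :=
    volume_measurePreserving_sumPiEquivProdPi fun _ : Fin n ⊕ Fin n => ℝ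
  have hpre : e ⁻¹' box n 1 = cube (Fin n ⊕ Fin n) 1 := by
    ext x
    simp only [Set.mem_preimage, box, cube, Set.mem_prod, Set.mem_univ_pi, Sum.forall]
    rfl
  have her : MeasurePreserving e (volume.restrict (cube (Fin n ⊕ Fin n) 1))
      (volume.restrict (box n 1)) := by
    rw [← hpre]
    exact he.restrict_preimage (measurableSet_box n 1)
  have h := hasSum_parseval_cube (hf.comp_measurePreserving her) (hg.comp_measurePreserving her)
  rw [← (Equiv.sumArrowEquivProdArrow (Fin n) (Fin n) ℤ).symm.hasSum_iff] at h
  rw [← her.integral_comp e.measurableEmbedding]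
  refine h.congr_fun fun (a : Lattice n) => ?_
  have hd : ∀ x : Fin n ⊕ Fin n → ℝ,
      (fun i => (((Equiv.sumArrowEquivProdArrow (Fin n) (Fin n) ℤ).symm a i : ℤ) : ℝ)) ⬝ᵥ x =
        a.toPhase.1 ⬝ᵥ (e x).1 + a.toPhase.2 ⬝ᵥ (e x).2 := fun x => by
    simp only [dotProduct, Fintype.sum_sum_type]
    rfl
  simp only [Function.comp_apply, hd]
  rw [← her.integral_comp e.measurableEmbedding, ← her.integral_comp e.measurableEmbedding]

/-! ### The Zak transform -/

/-- An integer vector regarded as a real vector. -/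
def intVec {n : ℕ} (p : Fin n → ℤ) : Fin n → ℝ := fun i => (p i : ℝ)

theorem intVec_add {n : ℕ} (p q : Fin n → ℤ) : intVec (p + q) = intVec p + intVec q := by
  ext; simp [intVec]

theorem intVec_sub {n : ℕ} (p q : Fin n → ℤ) : intVec (p - q) = intVec p - intVec q := by
  ext; simp [intVec]

theorem phase_intVec_dotProduct {n : ℕ} (p q : Fin n → ℤ) :
    phase (2 * Real.pi * (intVec p ⬝ᵥ intVec q)) = 1 := by
  rw [← phase_int (p ⬝ᵥ q)]
  simp [intVec, dotProduct]

/-- Continuous functions whose suprema over the translates of the unit cube are summable. -/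
structure IsWiener {n : ℕ} (A : (Fin n → ℝ) → ℂ) : Prop where
  continuous : Continuous A
  exists_bound : ∃ c : (Fin n → ℤ) → ℝ, Summable c ∧
    ∀ p, ∀ t ∈ cube (Fin n) 1, ‖A (t + intVec p)‖ ≤ c p

/-- The Zak transform `∑_p exp (-2πi v ⬝ p) A (t + p)`. -/
def zak {n : ℕ} (A : (Fin n → ℝ) → ℂ) (t v : Fin n → ℝ) : ℂ :=
  ∑' p : Fin n → ℤ, phase (-(2 * Real.pi * (v ⬝ᵥ intVec p))) * A (t + intVec p)

section Wiener

variable {n : ℕ} {A B : (Fin n → ℝ) → ℂ}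

theorem zero_mem_cube {ι : Type*} : (0 : ι → ℝ) ∈ cube ι 1 := fun _ _ => by simp

theorem exists_sub_mem_cube (x : Fin n → ℝ) : ∃ p : Fin n → ℤ, x - intVec p ∈ cube (Fin n) 1 :=
  ⟨fun i => ⌊x i⌋, fun i _ =>
    ⟨sub_nonneg.2 (Int.floor_le _), (Int.fract_lt_one (x i))⟩⟩

theorem IsWiener.exists_norm_le (hA : IsWiener A) : ∃ M, ∀ x, ‖A x‖ ≤ M := by
  obtain ⟨c, hc, hb⟩ := hA.exists_bound
  refine ⟨∑' p, c p, fun x => ?_⟩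
  obtain ⟨p, hp⟩ := exists_sub_mem_cube x
  have h := hb p _ hp
  rw [sub_add_cancel] at h
  exact h.trans (hc.le_tsum p fun q _ => (norm_nonneg _).trans (hb q 0 zero_mem_cube))

theorem IsWiener.mul_bounded (hA : IsWiener A) (hB : Continuous B) {M : ℝ}
    (hM : ∀ x, ‖B x‖ ≤ M) : IsWiener fun x => A x * B x := by
  obtain ⟨c, hc, hb⟩ := hA.exists_bound
  refine ⟨hA.continuous.mul hB, fun p => c p * M, hc.mul_right M, fun p t ht => ?_⟩
  rw [norm_mul]
  exact mul_le_mul (hb p t ht) (hM _) (norm_nonneg _) ((norm_nonneg _).trans (hb p t ht))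

theorem IsWiener.conj (hA : IsWiener A) : IsWiener fun x => starRingEnd ℂ (A x) := by
  obtain ⟨c, hc, hb⟩ := hA.exists_bound
  refine ⟨Complex.continuous_conj.comp hA.continuous, c, hc, fun p t ht => ?_⟩
  rw [RCLike.norm_conj]
  exact hb p t ht

/-- Unfolding an integral over `ℝⁿ` into a sum of integrals over the unit cube. -/
theorem IsWiener.hasSum_setIntegral (hA : IsWiener A) :
    HasSum (fun p => ∫ t in cube (Fin n) 1, A (t + intVec p)) (∫ x, A x) := by
  obtain ⟨c, hc, hb⟩ := hA.exists_bound
  -- The integer translates of the half-open unit cube tile ℝⁿ.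
  let s : (Fin n → ℤ) → Set (Fin n → ℝ) := fun p => (fun x => x - intVec p) ⁻¹' cube (Fin n) 1
  have hs : ∀ p, MeasurableSet (s p) := fun p =>
    (measurePreserving_shift (intVec p)).measurable (measurableSet_cube _ 1)
  have hsU : ⋃ p, s p = Set.univ := Set.eq_univ_of_forall fun x => by
    obtain ⟨p, hp⟩ := exists_sub_mem_cube x
    exact Set.mem_iUnion.2 ⟨p, hp⟩
  have hdisj : Pairwise fun p q => Disjoint (s p) (s q) := by
    intro p q hpq
    refine Set.disjoint_left.2 fun x hp hq => hpq ?_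
    ext i
    have h1 := hp i trivial
    have h2 := hq i trivial
    simp only [Pi.sub_apply, intVec, Set.mem_Ico] at h1 h2
    have h3 : (p i : ℝ) < q i + 1 := by linarith
    have h4 : (q i : ℝ) < p i + 1 := by linarith
    norm_cast at h3 h4
    omega
  have hvol : ∀ p, volume.real (s p) = 1 := fun p => by
    rw [Measure.real, (measurePreserving_shift (intVec p)).measure_preimage
      (measurableSet_cube _ 1).nullMeasurableSet, volume_cube]
    simp
  have hbs : ∀ p, ∀ x ∈ s p, ‖A x‖ ≤ c p := fun p x hx => by
    have := hb p _ hx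
    rwa [sub_add_cancel] at this
  have hfin : ∀ p, volume (s p) < ⊤ := fun p => by
    rw [(measurePreserving_shift (intVec p)).measure_preimage
      (measurableSet_cube _ 1).nullMeasurableSet]
    exact (volume_cube_ne_top _ _).lt_top
  have hint : ∀ p, IntegrableOn A (s p) := fun p =>
    Measure.integrableOn_of_bounded (hfin p).ne hA.continuous.aestronglyMeasurable
      (M := c p) ((ae_restrict_iff' (hs p)).2 (Filter.Eventually.of_forall (hbs p)))
  have hI : IntegrableOn A (⋃ p, s p) := by
    refine integrableOn_iUnion_of_summable_integral_norm hint ?_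
    refine Summable.of_nonneg_of_le (fun p => integral_nonneg fun _ => norm_nonneg _)
      (fun p => ?_) hc
    have := setIntegral_mono_on (hint p).norm (integrableOn_const (hfin p).ne) (hs p) (hbs p)
    simpa [hvol p] using this
  have h := hasSum_integral_iUnion hs hdisj hI
  rw [hsU, setIntegral_univ] at h
  refine h.congr_fun fun p => ?_
  rw [← (measurePreserving_shift (intVec p)).setIntegral_preimage_emb
    (MeasurableEquiv.subRight (intVec p)).measurableEmbedding]
  simp only [sub_add_cancel]
  rfl

theorem IsWiener.summable_zak (hA : IsWiener A) {t : Fin n → ℝ} (ht : t ∈ cube (Fin n) 1)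
    (v : Fin n → ℝ) :
    Summable fun p => ‖phase (-(2 * Real.pi * (v ⬝ᵥ intVec p))) * A (t + intVec p)‖ := by
  obtain ⟨c, hc, hb⟩ := hA.exists_bound
  refine Summable.of_nonneg_of_le (fun _ => norm_nonneg _) (fun p => ?_) hc
  rw [norm_mul, norm_phase, one_mul]
  exact hb p t ht

theorem IsWiener.exists_norm_zak_le (hA : IsWiener A) :
    ∃ M, ∀ x ∈ box n 1, ‖zak A x.1 x.2‖ ≤ M := by
  obtain ⟨c, hc, hb⟩ := hA.exists_bound
  refine ⟨∑' p, c p, fun x hx => tsum_of_norm_bounded hc.hasSum fun p => ?_⟩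
  rw [norm_mul, norm_phase, one_mul]
  exact hb p _ hx.1

theorem IsWiener.continuousOn_zak (hA : IsWiener A) :
    ContinuousOn (fun x : Phase n => zak A x.1 x.2) (box n 1) := by
  obtain ⟨c, hc, hb⟩ := hA.exists_bound
  have := hA.continuous
  refine continuousOn_tsum (u := c) (fun p => Continuous.continuousOn ?_) hc fun p x hx => ?_
  · unfold dotProduct
    fun_prop
  · rw [norm_mul, norm_phase, one_mul]
    exact hb p _ hx.1

theorem IsWiener.memLp_zak (hA : IsWiener A) (q : ENNReal) :
    MemLp (fun x : Phase n => zak A x.1 x.2) q (volume.restrict (box n 1)) := by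
  obtain ⟨M, hM⟩ := hA.exists_norm_zak_le
  have : IsFiniteMeasure (volume.restrict (box n 1)) :=
    isFiniteMeasure_restrict.2 (volume_box_ne_top _ _)
  exact MemLp.of_bound (hA.continuousOn_zak.aestronglyMeasurable (measurableSet_box n 1)) M
    ((ae_restrict_iff' (measurableSet_box n 1)).2 (Filter.Eventually.of_forall hM))

theorem IsWiener.memLp_zak_mul_zak (hA : IsWiener A) (hB : IsWiener B) (q : ENNReal) :
    MemLp (fun x : Phase n => starRingEnd ℂ (zak A x.1 x.2) * zak B x.1 x.2) q
      (volume.restrict (box n 1)) :=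
  MemLp.mul (p := ⊤) (q := q) (hB.memLp_zak q) (hA.memLp_zak ⊤).star

/-- The Fourier coefficients of a product of two Zak transforms. -/
theorem IsWiener.setIntegral_phase_zak_mul_zak (hA : IsWiener A) (hB : IsWiener B)
    (a : Lattice n) :
    ∫ x in box n 1, phase (2 * Real.pi * (a.toPhase.1 ⬝ᵥ x.1 + a.toPhase.2 ⬝ᵥ x.2)) *
        (starRingEnd ℂ (zak A x.1 x.2) * zak B x.1 x.2) =
      ∫ x, starRingEnd ℂ (A x) * (phase (2 * Real.pi * (a.toPhase.1 ⬝ᵥ x)) *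
        B (x + a.toPhase.2)) := by
  obtain ⟨c, hc, hb⟩ := hA.exists_bound
  obtain ⟨c', hc', hb'⟩ := hB.exists_bound
  obtain ⟨M, hM⟩ := hB.exists_norm_le
  have hAc := hA.continuous
  have hBc := hB.continuous
  have hcB : Continuous fun x =>
      phase (2 * Real.pi * (a.toPhase.1 ⬝ᵥ x)) * B (x + a.toPhase.2) := by
    unfold dotProduct
    fun_prop
  have hG := hA.conj.mul_bounded hcB (M := M) fun x => by
    rw [norm_mul, norm_phase, one_mul]; exact hM _
  -- The term of the doubly expanded product of Zak sums indexed by (p, q): its whole dependence on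
  -- v is the character with index p - q + a_Z.
  let F : (Fin n → ℤ) × (Fin n → ℤ) → Phase n → ℂ := fun p x =>
    (phase (2 * Real.pi * (a.toPhase.1 ⬝ᵥ x.1)) *
      (starRingEnd ℂ (A (x.1 + intVec p.1)) * B (x.1 + intVec p.2))) *
        phase (2 * Real.pi * (intVec (p.1 - p.2 + a.2) ⬝ᵥ x.2))
  have hFc : ∀ p, Continuous (F p) := fun p => by
    simp only [F, dotProduct]
    have := Complex.continuous_conj
    fun_prop
  have hFb : ∀ p, ∀ x ∈ box n 1, ‖F p x‖ ≤ c p.1 * c' p.2 := fun p x hx => by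
    simp only [F, norm_mul, norm_phase, one_mul, mul_one, RCLike.norm_conj]
    exact mul_le_mul (hb _ _ hx.1) (hb' _ _ hx.1) (norm_nonneg _)
      ((norm_nonneg _).trans (hb _ _ hx.1))
  have hcc : Summable fun p : (Fin n → ℤ) × (Fin n → ℤ) => c p.1 * c' p.2 :=
    hc.mul_of_nonneg hc' (fun p => (norm_nonneg _).trans (hb p 0 zero_mem_cube))
      fun p => (norm_nonneg _).trans (hb' p 0 zero_mem_cube)
  have hFi : ∀ p, IntegrableOn (F p) (box n 1) := fun p =>
    Measure.integrableOn_of_bounded (volume_box_ne_top n 1) (hFc p).aestronglyMeasurable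
      (M := c p.1 * c' p.2) ((ae_restrict_iff' (measurableSet_box n 1)).2
        (Filter.Eventually.of_forall (hFb p)))
  have hsum : ∀ x ∈ box n 1, phase (2 * Real.pi * (a.toPhase.1 ⬝ᵥ x.1 + a.toPhase.2 ⬝ᵥ x.2)) *
      (starRingEnd ℂ (zak A x.1 x.2) * zak B x.1 x.2) = ∑' p, F p x := fun x hx => by
    have h1 := hA.summable_zak hx.1 x.2
    rw [zak, zak, Complex.conj_tsum, tsum_mul_tsum_of_summable_norm
      (by simpa only [RCLike.norm_conj] using h1) (hB.summable_zak hx.1 x.2), ← tsum_mul_left]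
    refine tsum_congr fun p => ?_
    have h2 : 2 * Real.pi * (intVec (p.1 - p.2 + a.2) ⬝ᵥ x.2) =
        2 * Real.pi * (a.toPhase.2 ⬝ᵥ x.2) + 2 * Real.pi * (x.2 ⬝ᵥ intVec p.1) +
          -(2 * Real.pi * (x.2 ⬝ᵥ intVec p.2)) := by
      rw [intVec_add, intVec_sub, add_dotProduct, sub_dotProduct, dotProduct_comm x.2,
        dotProduct_comm x.2]
      change _ * (_ + a.toPhase.2 ⬝ᵥ x.2) = _
      ring
    simp only [F]
    rw [map_mul, conj_phase, neg_neg, mul_add, phase_add, h2, phase_add, phase_add]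
    ring
  -- Integration over v forces q = p + a_Z, and t may be replaced by t + p in the remaining
  -- character because p is integral.
  have hFint : ∀ p, ∫ x in box n 1, F p x =
      if p.1 + a.2 = p.2 then ∫ t in cube (Fin n) 1, starRingEnd ℂ (A (t + intVec p.1)) *
        (phase (2 * Real.pi * (a.toPhase.1 ⬝ᵥ (t + intVec p.1))) *
          B (t + intVec p.1 + a.toPhase.2)) else 0 := fun p => by
    have h2 := setIntegral_prod_mul (μ := (volume : Measure (Fin n → ℝ)))
      (ν := (volume : Measure (Fin n → ℝ)))
      (fun t => phase (2 * Real.pi * (a.toPhase.1 ⬝ᵥ t)) *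
        (starRingEnd ℂ (A (t + intVec p.1)) * B (t + intVec p.2)))
      (fun v => phase (2 * Real.pi * (intVec (p.1 - p.2 + a.2) ⬝ᵥ v)))
      (cube (Fin n) 1) (cube (Fin n) 1)
    rw [← Measure.volume_eq_prod, ← box_eq] at h2
    have h3 := setIntegral_cube_phase (mul_one (2 * Real.pi)) one_pos (p.1 - p.2 + a.2)
    refine h2.trans ?_
    rw [show (∫ v in cube (Fin n) 1, phase (2 * Real.pi * (intVec (p.1 - p.2 + a.2) ⬝ᵥ v))) = _
      from h3]
    by_cases h : p.1 + a.2 = p.2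
    · rw [if_pos h, if_pos (by rw [← h]; abel), Complex.ofReal_one, one_pow, mul_one]
      refine integral_congr_ae (Filter.Eventually.of_forall fun t => ?_)
      beta_reduce
      rw [dotProduct_add, mul_add, phase_add,
        show phase (2 * Real.pi * (a.toPhase.1 ⬝ᵥ intVec p.1)) = 1 from
          phase_intVec_dotProduct a.1 p.1, ← h, intVec_add, mul_one, add_assoc]
      exact mul_left_comm _ _ _
    · rw [if_neg h, if_neg fun h' => h (by rw [← sub_eq_zero, ← h']; abel), mul_zero]
  have hFs : Summable fun p => ∫ x in box n 1, ‖F p x‖ := by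
    refine Summable.of_nonneg_of_le (fun p => integral_nonneg fun _ => norm_nonneg _)
      (fun p => ?_) (hcc.mul_left (volume.real (box n 1)))
    have := setIntegral_mono_on (hFi p).norm
      (integrableOn_const (volume_box_ne_top n 1)) (measurableSet_box n 1) (hFb p)
    simpa using this
  rw [setIntegral_congr_fun (measurableSet_box n 1) hsum,
    ← integral_tsum_of_summable_integral_norm hFi hFs]
  have hFs' : Summable fun p => ∫ x in box n 1, F p x :=
    Summable.of_norm_bounded hFs fun p => norm_integral_le_integral_norm _
  -- One sum collapses; the other reassembles the integral over ℝⁿ from the unit cubes.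
  rw [hFs'.tsum_prod, ← hG.hasSum_setIntegral.tsum_eq]
  refine tsum_congr fun p => ?_
  simp only [hFint]
  rw [tsum_eq_single (p + a.2) fun q hq => if_neg fun h => hq h.symm, if_pos rfl]

/-- Parseval's identity for Zak transforms. -/
theorem IsWiener.hasSum_mul_conj {A' B' : (Fin n → ℝ) → ℂ} (hA : IsWiener A) (hB : IsWiener B)
    (hA' : IsWiener A') (hB' : IsWiener B') :
    HasSum (fun a : Lattice n =>
      (∫ x, starRingEnd ℂ (A x) * (phase (2 * Real.pi * (a.toPhase.1 ⬝ᵥ x)) *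
        B (x + a.toPhase.2))) *
      starRingEnd ℂ (∫ x, starRingEnd ℂ (A' x) * (phase (2 * Real.pi * (a.toPhase.1 ⬝ᵥ x)) *
        B' (x + a.toPhase.2))))
      (∫ x in box n 1, (starRingEnd ℂ (zak A x.1 x.2) * zak B x.1 x.2) *
        starRingEnd ℂ (starRingEnd ℂ (zak A' x.1 x.2) * zak B' x.1 x.2)) := by
  have h := hasSum_parseval_box (hA.memLp_zak_mul_zak hB 2) (hA'.memLp_zak_mul_zak hB' 2)
  refine h.congr_fun fun a => ?_
  rw [hA.setIntegral_phase_zak_mul_zak hB, hA'.setIntegral_phase_zak_mul_zak hB']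

end Wiener

/-! ### Summability over integer lattices -/

theorem summable_inv_one_add_abs_sq : Summable fun k : ℤ => ((1 + |(k : ℝ)|) ^ 2)⁻¹ := by
  have h : Summable fun k : ℕ => ((1 + |((k : ℤ) : ℝ)|) ^ 2)⁻¹ := by
    have := (summable_nat_add_iff 1).2 (Real.summable_one_div_nat_pow.2 one_lt_two)
    refine this.congr fun k => ?_
    simp [abs_of_nonneg, add_comm]
  refine Summable.of_nat_of_neg h (h.congr fun k => ?_)
  simp

theorem summable_mul_prod {ι κ : Type*} {f : ι → ℝ} {g : κ → ℝ} (hf : Summable f)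
    (hg : Summable g) (hf0 : ∀ i, 0 ≤ f i) (hg0 : ∀ k, 0 ≤ g k) :
    Summable fun p : ι × κ => f p.1 * g p.2 :=
  hf.mul_of_nonneg hg hf0 hg0

/-- A finite set of vectors lies in the product of its coordinate projections, over which the sum
factorizes; this bounds all partial sums. -/
theorem summable_pi_prod {ι κ : Type*} [Fintype ι] [DecidableEq κ] {f : κ → ℝ} (hf : Summable f)
    (h0 : ∀ k, 0 ≤ f k) : Summable fun p : ι → κ => ∏ i, f (p i) := by
  classical
  refine summable_of_sum_le (c := (∑' k, f k) ^ Fintype.card ι)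
    (fun p => Finset.prod_nonneg fun i _ => h0 _) fun s => ?_
  calc ∑ p ∈ s, ∏ i, f (p i)
      ≤ ∑ p ∈ Fintype.piFinset fun i => s.image fun p => p i, ∏ i, f (p i) := by
        refine Finset.sum_le_sum_of_subset_of_nonneg (fun p hp => ?_)
          fun p _ _ => Finset.prod_nonneg fun i _ => h0 _
        exact Fintype.mem_piFinset.2 fun i => Finset.mem_image_of_mem _ hp
    _ = ∏ i, ∑ k ∈ s.image fun p => p i, f k := by rw [Finset.prod_univ_sum]
    _ ≤ ∏ _i : ι, ∑' k, f k :=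
        Finset.prod_le_prod (fun i _ => Finset.sum_nonneg fun k _ => h0 k)
          fun i _ => hf.sum_le_tsum _ fun k _ => h0 k
    _ = (∑' k, f k) ^ Fintype.card ι := by simp

/-- Two powers per coordinate suffice: (1 + ‖p‖)^{2n} dominates the product of the (1 + |p_i|)²,
because ‖p‖ is the sup norm. -/
theorem summable_inv_one_add_norm_pow (n : ℕ) :
    Summable fun p : Fin n → ℤ => ((1 + ‖intVec p‖) ^ (2 * n))⁻¹ := by
  refine Summable.of_nonneg_of_le (fun p => by positivity) (fun p => ?_)
    (summable_pi_prod (ι := Fin n) summable_inv_one_add_abs_sq fun k => by positivity)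
  rw [Finset.prod_inv_distrib]
  refine inv_anti₀ (Finset.prod_pos fun i _ => by positivity) ?_
  rw [Finset.prod_pow, mul_comm 2 n, pow_mul]
  refine pow_le_pow_left₀ (Finset.prod_nonneg fun i _ => by positivity) ?_ 2
  calc ∏ i, (1 + |(p i : ℝ)|) ≤ ∏ _i : Fin n, (1 + ‖intVec p‖) :=
        Finset.prod_le_prod (fun i _ => by positivity) fun i _ =>
          add_le_add_right (norm_le_pi_norm (intVec p) i) 1
    _ = (1 + ‖intVec p‖) ^ n := by simp

/-! ### Schwartz functions -/

section Schwartz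

variable {n d : ℕ}

theorem exists_one_add_norm_pow_mul_le (φ : 𝓢(Fin n → ℝ, ℂ)) (K : ℕ) :
    ∃ C, ∀ x, (1 + ‖x‖) ^ K * ‖φ x‖ ≤ C :=
  ⟨_, fun x => by
    simpa using SchwartzMap.one_add_le_sup_seminorm_apply (𝕜 := ℂ) (m := (K, 0)) le_rfl le_rfl φ x⟩

theorem isWiener_schwartz_comp (φ : 𝓢(Fin n → ℝ, ℂ)) {σ : ℝ} (hσ : 0 < σ) (w : Fin n → ℝ) :
    IsWiener fun x => φ (σ • x - w) := by
  obtain ⟨C, hC⟩ := exists_one_add_norm_pow_mul_le φ (2 * n)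
  have hφ := φ.continuous
  -- Chosen so that 1 + ‖p‖ ≤ 2 + σ⁻¹(‖x‖ + ‖w‖) ≤ M(1 + ‖x‖), which converts decay in x into decay
  -- in p.
  set M := σ⁻¹ * (1 + ‖w‖) + 2 with hM
  have hM0 : 0 < M := by positivity
  refine ⟨by fun_prop, fun p => C * M ^ (2 * n) * ((1 + ‖intVec p‖) ^ (2 * n))⁻¹,
    (summable_inv_one_add_norm_pow n).mul_left _, fun p t ht => ?_⟩
  set x := σ • (t + intVec p) - w with hx
  have ht1 : ‖t‖ ≤ 1 := (pi_norm_le_iff_of_nonneg zero_le_one).2 fun i => by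
    rw [Real.norm_of_nonneg (ht i trivial).1]; exact (ht i trivial).2.le
  have h1 : ‖intVec p‖ ≤ σ⁻¹ * (‖x‖ + ‖w‖) + 1 := by
    have h2 : intVec p = σ⁻¹ • (x + w) - t := by
      rw [hx, sub_add_cancel, smul_smul, inv_mul_cancel₀ hσ.ne', one_smul]; abel
    rw [h2]
    refine (norm_sub_le _ _).trans (add_le_add ?_ ht1)
    rw [norm_smul, Real.norm_of_nonneg (inv_nonneg.2 hσ.le)]
    exact mul_le_mul_of_nonneg_left (norm_add_le _ _) (inv_nonneg.2 hσ.le)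
  have h2 : 1 + ‖intVec p‖ ≤ M * (1 + ‖x‖) := by
    have hs : 0 < σ⁻¹ := inv_pos.2 hσ
    have := mul_nonneg (mul_nonneg hs.le (norm_nonneg w)) (norm_nonneg x)
    have := norm_nonneg x
    rw [hM]
    nlinarith
  beta_reduce
  rw [← div_eq_mul_inv, le_div_iff₀ (by positivity)]
  calc ‖φ x‖ * (1 + ‖intVec p‖) ^ (2 * n) ≤ ‖φ x‖ * (M * (1 + ‖x‖)) ^ (2 * n) := by gcongr
    _ = ((1 + ‖x‖) ^ (2 * n) * ‖φ x‖) * M ^ (2 * n) := by rw [mul_pow]; ring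
    _ ≤ C * M ^ (2 * n) := mul_le_mul_of_nonneg_right (hC x) (by positivity)

/-- The matrix element of a displacement between two functions, without its constant phase. -/
def corr (d : ℕ) (φ ψ : (Fin n → ℝ) → ℂ) (a : Phase n) : ℂ :=
  ∫ q, starRingEnd ℂ (φ q) * (phase (ell d * (a.2 ⬝ᵥ q)) * ψ (q - ell d • a.1))

theorem inner_disp_toLp (hd : 0 < d) (φ ψ : 𝓢(Fin n → ℝ, ℂ)) (a : Phase n) :
    ⟪φ.toLp 2 volume, disp d a (ψ.toLp 2 volume)⟫_ℂ =
      phase (-(Real.pi * (a.1 ⬝ᵥ a.2) / d)) * corr d φ ψ a := by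
  rw [L2.inner_def, corr, ← integral_const_mul]
  refine integral_congr_ae ?_
  filter_upwards [φ.coeFn_toLp 2 volume, coeFn_disp d a (ψ.toLp 2 volume),
    dispFun_congr d a (ψ.coeFn_toLp 2 volume)] with q h1 h2 h3
  rw [h1, h2, h3, dispFun_eq hd, RCLike.inner_apply, sub_eq_add_neg, phase_add]
  ring

theorem integrable_corr (φ ψ : 𝓢(Fin n → ℝ, ℂ)) (a : Phase n) :
    Integrable fun q =>
      starRingEnd ℂ (φ q) * (phase (ell d * (a.2 ⬝ᵥ q)) * ψ (q - ell d • a.1)) := by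
  obtain ⟨C, hC⟩ := exists_one_add_norm_pow_mul_le ψ 0
  have h1 : Integrable fun q => starRingEnd ℂ (φ q) :=
    (Complex.conjCLE : ℂ →L[ℝ] ℂ).integrable_comp φ.integrable
  have hψ := ψ.continuous
  refine h1.mul_bdd (c := C) (Continuous.aestronglyMeasurable ?_)
    (Filter.Eventually.of_forall fun q => ?_)
  · unfold dotProduct; fun_prop
  · rw [norm_mul, norm_phase, one_mul]
    simpa using hC (q - ell d • a.1)

theorem norm_corr_le (hd : 0 < d) (φ ψ : 𝓢(Fin n → ℝ, ℂ)) (a : Phase n) :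
    ‖corr d φ ψ a‖ ≤ ‖φ.toLp 2 volume‖ * ‖ψ.toLp 2 volume‖ := by
  have h := norm_inner_le_norm (𝕜 := ℂ) (φ.toLp 2 volume) (disp d a (ψ.toLp 2 volume))
  rwa [inner_disp_toLp hd, norm_mul, norm_phase, one_mul, norm_disp_apply] at h

/-- Multiplication of a Schwartz function by a coordinate. -/
def coordMul (k : Fin n) (φ : 𝓢(Fin n → ℝ, ℂ)) : 𝓢(Fin n → ℝ, ℂ) :=
  SchwartzMap.smulLeftCLM ℂ (ContinuousLinearMap.proj (R := ℝ) (φ := fun _ : Fin n => ℝ) k) φ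

theorem coordMul_apply (k : Fin n) (φ : 𝓢(Fin n → ℝ, ℂ)) (q : Fin n → ℝ) :
    coordMul k φ q = (q k : ℂ) * φ q := by
  rw [coordMul, SchwartzMap.smulLeftCLM_apply_apply (by fun_prop)]
  simp

/-- A partial derivative of a Schwartz function. -/
def partialDeriv (k : Fin n) (φ : 𝓢(Fin n → ℝ, ℂ)) : 𝓢(Fin n → ℝ, ℂ) :=
  LineDeriv.lineDerivOp (Pi.single k (1 : ℝ) : Fin n → ℝ) φ

theorem hasLineDerivAt_partialDeriv (k : Fin n) (φ : 𝓢(Fin n → ℝ, ℂ)) (q : Fin n → ℝ) :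
    HasLineDerivAt ℝ φ (partialDeriv k φ q) q (Pi.single k 1) :=
  (φ.hasFDerivAt q).hasLineDerivAt _

/-- Under the integral, ℓ a_X is the difference between the position q and the shifted position q -
ℓ a_X. -/
theorem corr_coordMul (k : Fin n) (φ ψ : 𝓢(Fin n → ℝ, ℂ)) (a : Phase n) :
    ((ell d * a.1 k : ℝ) : ℂ) * corr d φ ψ a =
      corr d (coordMul k φ) ψ a - corr d φ (coordMul k ψ) a := by
  rw [corr, corr, corr, ← integral_sub (integrable_corr _ _ a) (integrable_corr _ _ a),
    ← integral_const_mul]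
  refine integral_congr_ae (Filter.Eventually.of_forall fun q => ?_)
  simp only [coordMul_apply, map_mul, Complex.conj_ofReal, Pi.sub_apply, Pi.smul_apply, smul_eq_mul]
  push_cast
  ring

theorem hasLineDerivAt_phase (c : ℝ) (z q : Fin n → ℝ) (k : Fin n) :
    HasLineDerivAt ℝ (fun q => phase (c * (z ⬝ᵥ q)))
      (Complex.I * ((c * z k : ℝ) : ℂ) * phase (c * (z ⬝ᵥ q))) q (Pi.single k 1) := by
  have h1 : HasDerivAt (fun t : ℝ => c * (z ⬝ᵥ (q + t • (Pi.single k 1 : Fin n → ℝ))))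
      (c * z k) 0 := by
    have h2 : ∀ t : ℝ, c * (z ⬝ᵥ (q + t • (Pi.single k 1 : Fin n → ℝ))) =
        c * (z ⬝ᵥ q) + t * (c * z k) := fun t => by
      rw [dotProduct_add, dotProduct_smul, dotProduct_single_one, smul_eq_mul]; ring
    simp only [h2]
    simpa using ((hasDerivAt_id (0 : ℝ)).mul_const (c * z k)).const_add (c * (z ⬝ᵥ q))
  have h3 := (h1.ofReal_comp.const_mul Complex.I).cexp
  rw [zero_smul, add_zero] at h3
  rw [mul_comm _ (phase _)]
  exact h3

/-- Integration by parts, where differentiating the character produces the factor iℓ a_Z. -/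
theorem corr_partialDeriv (k : Fin n) (φ ψ : 𝓢(Fin n → ℝ, ℂ)) (a : Phase n) :
    Complex.I * ((ell d * a.2 k : ℝ) : ℂ) * corr d φ ψ a =
      -corr d (partialDeriv k φ) ψ a - corr d φ (partialDeriv k ψ) a := by
  have h1 : ∀ q, HasLineDerivAt ℝ (fun q => starRingEnd ℂ (φ q))
      (starRingEnd ℂ (partialDeriv k φ q)) q (Pi.single k 1) := fun q =>
    ((Complex.conjCLE : ℂ →L[ℝ] ℂ).hasFDerivAt.comp_hasDerivAt _
      (hasLineDerivAt_partialDeriv k φ q))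
  have h2 : ∀ q, HasLineDerivAt ℝ (fun q => phase (ell d * (a.2 ⬝ᵥ q)) * ψ (q - ell d • a.1))
      (Complex.I * ((ell d * a.2 k : ℝ) : ℂ) * phase (ell d * (a.2 ⬝ᵥ q)) * ψ (q - ell d • a.1) +
        phase (ell d * (a.2 ⬝ᵥ q)) * partialDeriv k ψ (q - ell d • a.1)) q
      (Pi.single k 1) := fun q => by
    have h3 : HasDerivAt (fun t : ℝ => ψ (q + t • (Pi.single k 1 : Fin n → ℝ) - ell d • a.1))
        (partialDeriv k ψ (q - ell d • a.1)) 0 := by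
      have := hasLineDerivAt_partialDeriv k ψ (q - ell d • a.1)
      simp only [HasLineDerivAt] at this
      convert! this using 3
      abel
    have h4 := (hasLineDerivAt_phase (ell d) a.2 q k).mul h3
    simp only [zero_smul, add_zero] at h4
    exact h4
  have hi1 := integrable_corr (d := d) (partialDeriv k φ) ψ a
  have hi2 := (integrable_corr (d := d) φ ψ a).const_mul (Complex.I * ((ell d * a.2 k : ℝ) : ℂ))
  have hi3 := integrable_corr (d := d) φ (partialDeriv k ψ) a
  have hsplit : ∀ q, starRingEnd ℂ (φ q) *
      (Complex.I * ((ell d * a.2 k : ℝ) : ℂ) * phase (ell d * (a.2 ⬝ᵥ q)) * ψ (q - ell d • a.1) +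
        phase (ell d * (a.2 ⬝ᵥ q)) * partialDeriv k ψ (q - ell d • a.1)) =
      Complex.I * ((ell d * a.2 k : ℝ) : ℂ) * (starRingEnd ℂ (φ q) *
        (phase (ell d * (a.2 ⬝ᵥ q)) * ψ (q - ell d • a.1))) +
      starRingEnd ℂ (φ q) * (phase (ell d * (a.2 ⬝ᵥ q)) * partialDeriv k ψ (q - ell d • a.1)) :=
    fun q => by ring
  have h := integral_bilinear_hasLineDerivAt_right_eq_neg_left_of_integrable
    (μ := (volume : Measure (Fin n → ℝ))) (B := ContinuousLinearMap.mul ℝ ℂ)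
    (f := fun q => starRingEnd ℂ (φ q)) (f' := fun q => starRingEnd ℂ (partialDeriv k φ q))
    (g := fun q => phase (ell d * (a.2 ⬝ᵥ q)) * ψ (q - ell d • a.1))
    (v := Pi.single k 1) hi1
    (by
      simp only [ContinuousLinearMap.mul_apply', hsplit]
      exact hi2.add hi3)
    (integrable_corr φ ψ a) (fun q _ => h1 q) (fun q _ => h2 q)
  simp only [ContinuousLinearMap.mul_apply', hsplit] at h
  rw [integral_add hi2 hi3, integral_const_mul] at h
  rw [corr, corr, corr, eq_sub_iff_add_eq]
  exact h

/-- The weight `1 + ∑ |x_k| + ∑ |z_k|` on phase space. -/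
def weight (a : Phase n) : ℝ := 1 + ∑ k, |a.1 k| + ∑ k, |a.2 k|

theorem weight_pos (a : Phase n) : 0 < weight a := by
  have h1 : 0 ≤ ∑ k, |a.1 k| := Finset.sum_nonneg fun _ _ => abs_nonneg _
  have h2 : 0 ≤ ∑ k, |a.2 k| := Finset.sum_nonneg fun _ _ => abs_nonneg _
  unfold weight; linarith

/-- Matrix elements of displacements between Schwartz functions decay rapidly. -/
theorem exists_weight_pow_mul_corr_le (hd : 0 < d) (K : ℕ) :
    ∀ φ ψ : 𝓢(Fin n → ℝ, ℂ), ∃ C, ∀ a, weight a ^ K * ‖corr d φ ψ a‖ ≤ C := by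
  have hl := ell_pos hd
  -- The bound is proved for all pairs of functions at once: each further weight factor is traded
  -- for a coordinate multiplication or a derivative on one of them. The base case is
  -- Cauchy–Schwarz.
  induction K with
  | zero => exact fun φ ψ => ⟨_, fun a => by simpa using norm_corr_le hd φ ψ a⟩
  | succ K ih =>
    intro φ ψ
    choose C hC using ih
    let c1 : Fin n → ℝ := fun k => (ell d)⁻¹ * (C (coordMul k φ) ψ + C φ (coordMul k ψ))
    let c2 : Fin n → ℝ := fun k => (ell d)⁻¹ * (C (partialDeriv k φ) ψ + C φ (partialDeriv k ψ))
    refine ⟨C φ ψ + ∑ k, c1 k + ∑ k, c2 k, fun a => ?_⟩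
    have hw := (pow_pos (weight_pos a) K).le
    have h1 : ∀ k, weight a ^ K * (|a.1 k| * ‖corr d φ ψ a‖) ≤ c1 k := fun k => by
      have h := congrArg norm (corr_coordMul (d := d) k φ ψ a)
      rw [norm_mul, Complex.norm_real, Real.norm_eq_abs, abs_mul, abs_of_pos hl] at h
      rw [le_inv_mul_iff₀ hl]
      calc ell d * (weight a ^ K * (|a.1 k| * ‖corr d φ ψ a‖))
          = weight a ^ K * ‖corr d (coordMul k φ) ψ a - corr d φ (coordMul k ψ) a‖ := by
            rw [← h]; ring
        _ ≤ weight a ^ K * (‖corr d (coordMul k φ) ψ a‖ + ‖corr d φ (coordMul k ψ) a‖) :=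
            mul_le_mul_of_nonneg_left (norm_sub_le _ _) hw
        _ ≤ _ := by rw [mul_add]; exact add_le_add (hC _ _ a) (hC _ _ a)
    have h2 : ∀ k, weight a ^ K * (|a.2 k| * ‖corr d φ ψ a‖) ≤ c2 k := fun k => by
      have h := congrArg norm (corr_partialDeriv (d := d) k φ ψ a)
      rw [norm_mul, norm_mul, Complex.norm_I, one_mul, Complex.norm_real, Real.norm_eq_abs,
        abs_mul, abs_of_pos hl] at h
      rw [le_inv_mul_iff₀ hl]
      calc ell d * (weight a ^ K * (|a.2 k| * ‖corr d φ ψ a‖))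
          = weight a ^ K * ‖-corr d (partialDeriv k φ) ψ a - corr d φ (partialDeriv k ψ) a‖ := by
            rw [← h]; ring
        _ ≤ weight a ^ K * (‖corr d (partialDeriv k φ) ψ a‖ + ‖corr d φ (partialDeriv k ψ) a‖) := by
            refine mul_le_mul_of_nonneg_left ((norm_sub_le _ _).trans ?_) hw
            rw [norm_neg]
        _ ≤ _ := by rw [mul_add]; exact add_le_add (hC _ _ a) (hC _ _ a)
    calc weight a ^ (K + 1) * ‖corr d φ ψ a‖
        = weight a ^ K * ‖corr d φ ψ a‖ + ∑ k, weight a ^ K * (|a.1 k| * ‖corr d φ ψ a‖) +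
            ∑ k, weight a ^ K * (|a.2 k| * ‖corr d φ ψ a‖) := by
          rw [← Finset.mul_sum, ← Finset.mul_sum, ← Finset.sum_mul, ← Finset.sum_mul, pow_succ]
          nth_rewrite 2 [weight]
          ring
      _ ≤ _ := add_le_add (add_le_add (hC _ _ a) (Finset.sum_le_sum fun k _ => h1 k))
          (Finset.sum_le_sum fun k _ => h2 k)

theorem norm_le_sum_abs (x : Fin n → ℝ) : ‖x‖ ≤ ∑ k, |x k| :=
  (pi_norm_le_iff_of_nonneg (Finset.sum_nonneg fun _ _ => abs_nonneg _)).2 fun k =>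
    Finset.single_le_sum (f := fun k => |x k|) (fun _ _ => abs_nonneg _) (Finset.mem_univ k)

/-- The weight dominates both 1 + ‖a_X‖ and 1 + ‖a_Z‖, so decay of order 2n + 2n provides a product
of two summable factors. -/
theorem summable_norm_corr (hd : 0 < d) (φ ψ : 𝓢(Fin n → ℝ, ℂ)) :
    Summable fun a : Lattice n => ‖corr d φ ψ a.toPhase‖ := by
  obtain ⟨C, hC⟩ := exists_weight_pow_mul_corr_le hd (2 * n + 2 * n) φ ψ
  have hs := ((summable_inv_one_add_norm_pow n).mul_of_nonneg (summable_inv_one_add_norm_pow n)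
    (fun p => by positivity) (fun p => by positivity)).mul_left C
  refine Summable.of_nonneg_of_le (fun _ => norm_nonneg _) (fun a => ?_) hs
  have hx : 0 ≤ ∑ k, |a.toPhase.1 k| := Finset.sum_nonneg fun _ _ => abs_nonneg _
  have hz : 0 ≤ ∑ k, |a.toPhase.2 k| := Finset.sum_nonneg fun _ _ => abs_nonneg _
  have h1 : 1 + ‖intVec a.1‖ ≤ weight a.toPhase := by
    have : ‖intVec a.1‖ ≤ ∑ k, |a.toPhase.1 k| := norm_le_sum_abs _
    unfold weight; linarith
  have h2 : 1 + ‖intVec a.2‖ ≤ weight a.toPhase := by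
    have : ‖intVec a.2‖ ≤ ∑ k, |a.toPhase.2 k| := norm_le_sum_abs _
    unfold weight; linarith
  rw [← mul_inv, ← div_eq_mul_inv, le_div_iff₀ (by positivity), mul_comm]
  refine le_trans (mul_le_mul_of_nonneg_right ?_ (norm_nonneg _)) (hC a.toPhase)
  have := weight_pos a.toPhase
  rw [pow_add]
  gcongr

theorem summable_norm_inner_disp (hd : 0 < d) (φ ψ : 𝓢(Fin n → ℝ, ℂ)) :
    Summable fun a : Lattice n => ‖⟪φ.toLp 2 volume, disp d a.toPhase (ψ.toLp 2 volume)⟫_ℂ‖ := by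
  refine (summable_norm_corr hd φ ψ).congr fun a => ?_
  rw [inner_disp_toLp hd, norm_mul, norm_phase, one_mul]

end Schwartz

/-! ### The GKP forms in terms of Zak transforms -/

section GKP

variable {n d : ℕ}

/-- A vector of residues regarded as a real vector. -/
def natVec (j : Fin n → Fin d) : Fin n → ℝ := fun k => ((j k : ℕ) : ℝ)

/-- The function `x ↦ φ (d ℓ (x - w))`. -/
def scaled (d : ℕ) (φ : (Fin n → ℝ) → ℂ) (w x : Fin n → ℝ) : ℂ := φ ((d * ell d) • (x - w))

theorem isWiener_scaled (hd : 0 < d) (φ : 𝓢(Fin n → ℝ, ℂ)) (w : Fin n → ℝ) :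
    IsWiener (scaled d φ w) := by
  have hd' : (0 : ℝ) < d := by exact_mod_cast hd
  have h := isWiener_schwartz_comp φ (mul_pos hd' (ell_pos hd)) ((d * ell d) • w)
  simp only [← smul_sub] at h
  exact h

theorem zak_scaled (φ : (Fin n → ℝ) → ℂ) (w t v : Fin n → ℝ) :
    zak (scaled d φ w) t v = zak (scaled d φ 0) (t - w) v := by
  refine tsum_congr fun p => ?_
  rw [scaled, scaled, sub_zero, add_sub_right_comm]

theorem zak_add_intVec (A : (Fin n → ℝ) → ℂ) (t v : Fin n → ℝ) (e : Fin n → ℤ) :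
    zak A (t + intVec e) v = phase (2 * Real.pi * (v ⬝ᵥ intVec e)) * zak A t v := by
  rw [zak, zak, ← tsum_mul_left, ← (Equiv.addRight e).tsum_eq
    fun p => phase (2 * Real.pi * (v ⬝ᵥ intVec e)) *
      (phase (-(2 * Real.pi * (v ⬝ᵥ intVec p))) * A (t + intVec p))]
  refine tsum_congr fun p => ?_
  rw [Equiv.coe_addRight, ← mul_assoc, ← phase_add, intVec_add, dotProduct_add]
  congr 2
  · ring
  · abel

/-- The product `conj (Z φ) Z α` of Zak transforms of rescaled functions. -/
def zakProd (d : ℕ) (φ α : (Fin n → ℝ) → ℂ) (t v : Fin n → ℝ) : ℂ :=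
  starRingEnd ℂ (zak (scaled d φ 0) t v) * zak (scaled d α 0) t v

/-- A Zak transform is only quasi-periodic in t, but its phase does not depend on the function and
cancels against the conjugate factor. -/
theorem zakProd_add_intVec (φ α : (Fin n → ℝ) → ℂ) (t v : Fin n → ℝ) (e : Fin n → ℤ) :
    zakProd d φ α (t + intVec e) v = zakProd d φ α t v := by
  rw [zakProd, zakProd, zak_add_intVec, zak_add_intVec, map_mul, mul_mul_mul_comm, conj_phase,
    ← phase_add, neg_add_cancel, phase_zero, one_mul]

theorem zakProd_sub_intVec (φ α : (Fin n → ℝ) → ℂ) (t v : Fin n → ℝ) (e : Fin n → ℤ) :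
    zakProd d φ α (t - intVec e) v = zakProd d φ α t v := by
  rw [← zakProd_add_intVec φ α (t - intVec e) v e, sub_add_cancel]

/-- The point `(j + u) / d`. -/
def cellPoint (j : Fin n → Fin d) (u : Fin n → ℝ) : Fin n → ℝ := (d : ℝ)⁻¹ • (natVec j + u)

/-- The displaced comb samples f at ℓ(dm + j + s_X) = dℓ(m + (j + s_X)/d) with weights exp(-2πi s_Z
⬝ m), up to a phase independent of m and f: a Zak transform of the rescaled function. -/
theorem gkpBra_dispFun_neg (hd : 0 < d) (j : Fin n → Fin d) (s : Phase n)
    (f : (Fin n → ℝ) → ℂ) :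
    gkpBra d j (dispFun d (-s) f) =
      phase (-(2 * Real.pi / d * (s.2 ⬝ᵥ natVec j)) - Real.pi * (s.1 ⬝ᵥ s.2) / d) *
        ((((Real.sqrt (ell d))⁻¹ ^ n : ℝ) : ℂ) * zak (scaled d f 0) (cellPoint j s.1) s.2) := by
  have hd' : (d : ℝ) ≠ 0 := by positivity
  rw [gkpBra, zak, mul_left_comm]
  congr 1
  rw [← tsum_mul_left]
  refine tsum_congr fun m => ?_
  have h1 : (fun k => ell d * ((d : ℝ) * (m k : ℝ) + ((j k : ℕ) : ℝ))) =
      ell d • ((d : ℝ) • intVec m + natVec j) := rfl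
  rw [h1, dispFun_eq hd, ← mul_assoc, ← phase_add, scaled]
  congr 1
  · congr 1
    simp only [Prod.fst_neg, Prod.snd_neg, neg_dotProduct, dotProduct_neg, dotProduct_smul,
      dotProduct_add, smul_eq_mul, mul_neg, neg_neg]
    rw [← mul_assoc, ell_mul_ell hd]
    field_simp
    ring
  · congr 1
    rw [sub_zero, cellPoint, Prod.fst_neg, smul_neg, sub_neg_eq_add, smul_add, smul_add,
      smul_smul (d * ell d), mul_right_comm, mul_inv_cancel₀ hd', one_mul, smul_add,
      smul_smul (ell d), mul_comm (ell d) (d : ℝ)]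
    abel

/-- The unimodular prefactors of bra and ket cancel, and the two factors ℓ^{-n/2} combine. -/
theorem gkpForm_eq (hd : 0 < d) (s : Phase n) (f g : (Fin n → ℝ) → ℂ) :
    gkpForm d s f g = (((ell d)⁻¹ ^ n : ℝ) : ℂ) *
      ∑ j : Fin n → Fin d, zakProd d f g (cellPoint j s.1) s.2 := by
  rw [gkpForm, Finset.mul_sum]
  refine Finset.sum_congr rfl fun j _ => ?_
  rw [gkpBra_dispFun_neg hd, gkpBra_dispFun_neg hd, map_mul, mul_mul_mul_comm, conj_phase,
    ← phase_add, neg_add_cancel, phase_zero, one_mul, map_mul, mul_mul_mul_comm,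
    Complex.conj_ofReal, ← Complex.ofReal_mul, ← mul_pow, ← mul_inv,
    Real.mul_self_sqrt (ell_pos hd).le, zakProd]

theorem cellPoint_mem_cube (j : Fin n → Fin d) {u : Fin n → ℝ} (hu : u ∈ cube (Fin n) 1) :
    cellPoint j u ∈ cube (Fin n) 1 := by
  intro k _
  have hd : (0 : ℝ) < d := by exact_mod_cast (j k).pos
  have h1 : ((j k : ℕ) : ℝ) + 1 ≤ d := by exact_mod_cast (j k).2
  have h2 := hu k trivial
  simp only [cellPoint, natVec, Pi.smul_apply, Pi.add_apply, smul_eq_mul, Set.mem_Ico] at h2 ⊢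
  constructor
  · have := h2.1; positivity
  · rw [inv_mul_lt_iff₀ hd]; linarith

theorem cellPoint_mem_cell_iff (hd : 0 < d) (j : Fin n → Fin d) (u : Fin n → ℝ) :
    cellPoint j u ∈ cell (d : ℝ)⁻¹ j ↔ u ∈ cube (Fin n) 1 := by
  have hd' : (0 : ℝ) < (d : ℝ)⁻¹ := by positivity
  simp only [cell, cube, Set.mem_univ_pi, cellPoint, natVec, Pi.smul_apply, Pi.add_apply,
    smul_eq_mul, Set.mem_Ico, mul_le_mul_iff_right₀ hd', mul_lt_mul_iff_right₀ hd',
    le_add_iff_nonneg_right, add_lt_add_iff_left]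

theorem setIntegral_cell_eq (hd : 0 < d) (f : (Fin n → ℝ) → ℂ) (j : Fin n → Fin d) :
    ∫ x in cell (d : ℝ)⁻¹ j, f x =
      ((((d : ℝ) ^ n)⁻¹ : ℝ) : ℂ) * ∫ u in cube (Fin n) 1, f (cellPoint j u) := by
  have hd' : (d : ℝ) ≠ 0 := by positivity
  have h1 := Measure.integral_comp_smul (volume : Measure (Fin n → ℝ))
    ((cell (d : ℝ)⁻¹ j).indicator f) (d : ℝ)⁻¹
  rw [← integral_add_left_eq_self _ (natVec j)] at h1
  rw [integral_indicator (measurableSet_cell _ j), Module.finrank_fin_fun, inv_pow, inv_inv,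
    abs_of_nonneg (by positivity)] at h1
  have h2 : ∀ u, (cell (d : ℝ)⁻¹ j).indicator f ((d : ℝ)⁻¹ • (natVec j + u)) =
      (cube (Fin n) 1).indicator (fun u => f (cellPoint j u)) u := fun u => by
    by_cases hu : u ∈ cube (Fin n) 1
    · rw [Set.indicator_of_mem hu]
      exact Set.indicator_of_mem ((cellPoint_mem_cell_iff hd j u).2 hu) f
    · rw [Set.indicator_of_notMem hu]
      exact Set.indicator_of_notMem (fun h => hu ((cellPoint_mem_cell_iff hd j u).1 h)) f
  simp only [h2] at h1
  rw [integral_indicator (measurableSet_cube _ 1)] at h1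
  rw [h1, Complex.real_smul, ← mul_assoc, ← Complex.ofReal_mul, inv_mul_cancel₀ (by positivity),
    Complex.ofReal_one, one_mul]

/-- Only the position variable is subdivided, into dⁿ cubes of side 1/d, each rescaled to the unit
cube by x = (j + u)/d. -/
theorem setIntegral_box_eq_sum_cellPoint (hd : 0 < d) {G : Phase n → ℂ}
    (hG : IntegrableOn G (box n 1))
    (hG' : ∀ j : Fin n → Fin d, IntegrableOn (fun x : Phase n => G (cellPoint j x.1, x.2))
      (box n 1)) :
    ∫ x in box n 1, G x = ((((d : ℝ) ^ n)⁻¹ : ℝ) : ℂ) *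
      ∑ j : Fin n → Fin d, ∫ x in box n 1, G (cellPoint j x.1, x.2) := by
  have hd' : (d : ℝ) ≠ 0 := by positivity
  rw [box_eq, Measure.volume_eq_prod] at hG hG' ⊢
  rw [setIntegral_prod _ hG]
  have hI : IntegrableOn (fun t => ∫ v in cube (Fin n) 1, G (t, v)) (cube (Fin n) 1) := by
    rw [IntegrableOn, ← Measure.prod_restrict] at hG
    exact hG.integral_prod_left
  have h := sum_setIntegral_cell (d := d) (r := (d : ℝ)⁻¹) (by positivity)
    (f := fun t => ∫ v in cube (Fin n) 1, G (t, v))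
  rw [mul_inv_cancel₀ hd'] at h
  rw [← h hI, Finset.mul_sum]
  refine Finset.sum_congr rfl fun j _ => ?_
  rw [setIntegral_cell_eq hd, setIntegral_prod _ (hG' j)]

theorem IsWiener.memLp_zak_cellPoint {A : (Fin n → ℝ) → ℂ} (hA : IsWiener A) (j : Fin n → Fin d) :
    MemLp (fun x : Phase n => zak A (cellPoint j x.1) x.2) ⊤ (volume.restrict (box n 1)) := by
  obtain ⟨M, hM⟩ := hA.exists_norm_zak_le
  have hmaps : Set.MapsTo (fun x : Phase n => (cellPoint j x.1, x.2)) (box n 1) (box n 1) :=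
    fun x hx => ⟨cellPoint_mem_cube j hx.1, hx.2⟩
  have hc : ContinuousOn (fun x : Phase n => zak A (cellPoint j x.1) x.2) (box n 1) := by
    refine hA.continuousOn_zak.comp (Continuous.continuousOn ?_) hmaps
    unfold cellPoint
    fun_prop
  exact memLp_top_of_bound (hc.aestronglyMeasurable (measurableSet_box n 1)) M
    ((ae_restrict_iff' (measurableSet_box n 1)).2
      (Filter.Eventually.of_forall fun x hx => hM _ (hmaps hx)))

theorem memLp_zakProd_cellPoint (hd : 0 < d) (φ α : 𝓢(Fin n → ℝ, ℂ)) (w : Fin n → ℝ)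
    (j : Fin n → Fin d) :
    MemLp (fun x : Phase n => zakProd d φ α (cellPoint j x.1 - w) x.2) ⊤
      (volume.restrict (box n 1)) := by
  simp only [zakProd, ← zak_scaled]
  exact MemLp.mul (p := ⊤) (q := ⊤) ((isWiener_scaled hd α w).memLp_zak_cellPoint j)
    ((isWiener_scaled hd φ w).memLp_zak_cellPoint j).star

theorem memLp_zakProd (hd : 0 < d) (φ α : 𝓢(Fin n → ℝ, ℂ)) (w : Fin n → ℝ) :
    MemLp (fun x : Phase n => zakProd d φ α (x.1 - w) x.2) ⊤ (volume.restrict (box n 1)) := by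
  simp only [zakProd, ← zak_scaled]
  exact (isWiener_scaled hd φ w).memLp_zak_mul_zak (isWiener_scaled hd α w) ⊤

theorem integrableOn_box_mul {f g : Phase n → ℂ} (hf : MemLp f ⊤ (volume.restrict (box n 1)))
    (hg : MemLp g ⊤ (volume.restrict (box n 1))) : IntegrableOn (fun x => f x * g x) (box n 1) := by
  have : IsFiniteMeasure (volume.restrict (box n 1)) :=
    isFiniteMeasure_restrict.2 (volume_box_ne_top _ _)
  exact (MemLp.mul (p := ⊤) (q := ⊤) (r := ⊤) hg hf).integrable le_top

/-- The sum of a function of period `1` over the cosets of `d⁻¹ ℤⁿ / ℤⁿ`. -/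
theorem sum_zakProd_sub (hd : 0 < d) (φ α : (Fin n → ℝ) → ℂ) (j : Fin n → Fin d)
    (u v : Fin n → ℝ) :
    ∑ r : Fin n → Fin d, zakProd d φ α (cellPoint j u - (d : ℝ)⁻¹ • natVec r) v =
      ∑ k : Fin n → Fin d, zakProd d φ α (cellPoint k u) v := by
  have : NeZero d := ⟨hd.ne'⟩
  have hd' : (d : ℝ) ≠ 0 := by positivity
  -- Substitute k = j - r in residues mod d. A coordinate with j < r wraps around, which shifts the
  -- point by one unit; the integer vector below absorbs that by periodicity.
  rw [← (Equiv.subLeft j).sum_comp fun k => zakProd d φ α (cellPoint k u) v]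
  refine Finset.sum_congr rfl fun r _ => ?_
  rw [Equiv.subLeft_apply, ← zakProd_sub_intVec φ α (cellPoint (j - r) u) v
    fun k => if (r k : ℕ) ≤ j k then 0 else 1]
  congr 1
  ext k
  simp only [cellPoint, natVec, intVec, Pi.sub_apply, Pi.smul_apply, Pi.add_apply, smul_eq_mul]
  have hval : (((j k - r k : Fin d) : ℕ) : ℝ) =
      (j k : ℕ) - (r k : ℕ) + (d : ℝ) * ((if (r k : ℕ) ≤ j k then (0 : ℤ) else 1 : ℤ) : ℝ) := by
    split_ifs with h
    · rw [Fin.coe_sub_iff_le.2 h, Nat.cast_sub h]; simp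
    · rw [Fin.coe_sub_iff_lt.2 (not_le.1 h), Nat.cast_sub (by omega)]
      push_cast; ring
  rw [hval]
  field_simp
  ring

/-- The integral of two GKP forms as a sum of integrals of Zak transforms. -/
theorem sum_setIntegral_zakProd (hd : 0 < d) (φ α β ψ : 𝓢(Fin n → ℝ, ℂ)) :
    ∑ r : Fin n → Fin d, ∫ x in box n 1,
        zakProd d φ α x.1 x.2 * zakProd d β ψ (x.1 - (d : ℝ)⁻¹ • natVec r) x.2 =
      ((((d : ℝ) ^ n)⁻¹ * ell d ^ (2 * n) : ℝ) : ℂ) *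
        ∫ s in box n 1, gkpForm d s φ α * gkpForm d s β ψ := by
  have hl := (ell_pos hd).ne'
  have hint : ∀ j r : Fin n → Fin d, IntegrableOn (fun x : Phase n =>
      zakProd d φ α (cellPoint j x.1) x.2 *
        zakProd d β ψ (cellPoint j x.1 - (d : ℝ)⁻¹ • natVec r) x.2) (box n 1) := fun j r => by
    have h := memLp_zakProd_cellPoint hd φ α 0 j
    simp only [sub_zero] at h
    exact integrableOn_box_mul h (memLp_zakProd_cellPoint hd β ψ _ j)
  have h1 : ∀ r : Fin n → Fin d, ∫ x in box n 1,
        zakProd d φ α x.1 x.2 * zakProd d β ψ (x.1 - (d : ℝ)⁻¹ • natVec r) x.2 =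
      ((((d : ℝ) ^ n)⁻¹ : ℝ) : ℂ) * ∑ j : Fin n → Fin d, ∫ x in box n 1,
        zakProd d φ α (cellPoint j x.1) x.2 *
          zakProd d β ψ (cellPoint j x.1 - (d : ℝ)⁻¹ • natVec r) x.2 := fun r => by
    have h := memLp_zakProd hd φ α 0
    simp only [sub_zero] at h
    exact setIntegral_box_eq_sum_cellPoint hd
      (integrableOn_box_mul h (memLp_zakProd hd β ψ ((d : ℝ)⁻¹ • natVec r))) fun j => hint j r
  -- The sum over r of the second factor does not depend on j, so the double sum is a product of two
  -- GKP forms.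
  have h2 : ∀ s : Phase n, gkpForm d s φ α * gkpForm d s β ψ =
      (((ell d ^ (2 * n))⁻¹ : ℝ) : ℂ) * ∑ j : Fin n → Fin d, ∑ r : Fin n → Fin d,
        zakProd d φ α (cellPoint j s.1) s.2 *
          zakProd d β ψ (cellPoint j s.1 - (d : ℝ)⁻¹ • natVec r) s.2 := fun s => by
    simp only [← Finset.mul_sum, sum_zakProd_sub hd]
    rw [gkpForm_eq hd, gkpForm_eq hd, mul_mul_mul_comm, ← Complex.ofReal_mul, ← pow_add, ← two_mul,
      inv_pow, Finset.sum_mul]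
  simp only [h2]
  rw [integral_const_mul,
    integral_finsetSum _ fun j _ => integrable_finsetSum _ fun r _ => hint j r]
  simp only [h1]
  rw [← Finset.mul_sum, Finset.sum_comm, ← mul_assoc, ← Complex.ofReal_mul, mul_assoc,
    mul_inv_cancel₀ (pow_ne_zero _ hl), mul_one]
  congr 1
  refine Finset.sum_congr rfl fun j _ => ?_
  rw [integral_finsetSum _ fun r _ => hint j r]

theorem integrable_gkpForm_mul (hd : 0 < d) (φ α β ψ : 𝓢(Fin n → ℝ, ℂ)) :
    Integrable (fun s => gkpForm d s φ α * gkpForm d s β ψ) (cellMeasure n d) := by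
  have h1 : ∀ f g : 𝓢(Fin n → ℝ, ℂ),
      MemLp (fun s => gkpForm d s f g) ⊤ (volume.restrict (box n 1)) := fun f g => by
    simp only [gkpForm_eq hd]
    have h : ∀ j : Fin n → Fin d, MemLp (fun s : Phase n => zakProd d f g (cellPoint j s.1) s.2) ⊤
        (volume.restrict (box n 1)) := fun j => by
      have h := memLp_zakProd_cellPoint hd f g 0 j
      simpa only [sub_zero] using h
    have hsum := memLp_finsetSum (ε' := ℂ) (p := ⊤) (μ := volume.restrict (box n 1)) Finset.univ
      (f := fun (j : Fin n → Fin d) (s : Phase n) => zakProd d f g (cellPoint j s.1) s.2)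
      fun j _ => h j
    exact hsum.const_mul (((ell d)⁻¹ ^ n : ℝ) : ℂ)
  exact (integrableOn_box_mul (h1 φ α) (h1 β ψ)).smul_measure ENNReal.ofReal_ne_top

/-- Every integer is `r - d m` for a unique residue `r` and a unique `m`. -/
def intSplit (hd : 0 < d) : Fin d × ℤ ≃ ℤ where
  toFun p := ((p.1 : ℕ) : ℤ) - d * p.2
  invFun b := (⟨(b % d).toNat, by
    have hd' : (0 : ℤ) < d := by exact_mod_cast hd
    have h1 := Int.emod_nonneg b hd'.ne'
    have h2 := Int.emod_lt_of_pos b hd'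
    omega⟩, -(b / d))
  left_inv p := by
    have hd' : (0 : ℤ) < d := by exact_mod_cast hd
    have h0 : ((p.1 : ℕ) : ℤ) < d := by exact_mod_cast p.1.2
    have h1 : (((p.1 : ℕ) : ℤ) - d * p.2) % d = (p.1 : ℕ) := by
      rw [Int.sub_mul_emod_self_left]
      exact Int.emod_eq_of_lt (Int.natCast_nonneg _) h0
    have h2 : (((p.1 : ℕ) : ℤ) - d * p.2) / d = -p.2 := by
      rw [sub_eq_add_neg, ← mul_neg, Int.add_mul_ediv_left _ _ hd'.ne',
        Int.ediv_eq_zero_of_lt (Int.natCast_nonneg _) h0, zero_add]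
    refine Prod.ext (Fin.ext ?_) ?_
    · simp only [h1, Int.toNat_natCast]
    · simp only [h2, neg_neg]
  right_inv b := by
    have hd' : (0 : ℤ) < d := by exact_mod_cast hd
    have h1 := Int.emod_nonneg b hd'.ne'
    have h2 := Int.mul_ediv_add_emod b d
    simp only [Int.toNat_of_nonneg h1]
    linarith

/-- Every lattice vector is `(r - d a_Z, a_X)` for unique residues `r` and a unique `a`. -/
def latticeSplit (hd : 0 < d) : (Fin n → Fin d) × Lattice n ≃ Lattice n where
  toFun p := (fun k => intSplit hd (p.1 k, p.2.2 k), p.2.1)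
  invFun b := (fun k => ((intSplit hd).symm (b.1 k)).1,
    (b.2, fun k => ((intSplit hd).symm (b.1 k)).2))
  left_inv p := by simp
  right_inv b := by simp

/-- Substitute q = dℓx. Since dℓ² = 2π, the modulation becomes an integer character, and the
translation by ℓ(r - d a_Z) becomes one by r/d - a_Z. -/
theorem corr_latticeSplit (hd : 0 < d) (φ ψ : (Fin n → ℝ) → ℂ) (r : Fin n → Fin d)
    (a : Lattice n) :
    corr d φ ψ (latticeSplit hd (r, a)).toPhase = (((d * ell d) ^ n : ℝ) : ℂ) *
      ∫ x, starRingEnd ℂ (scaled d φ 0 x) * (phase (2 * Real.pi * (a.toPhase.1 ⬝ᵥ x)) *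
        scaled d ψ ((d : ℝ)⁻¹ • natVec r) (x + a.toPhase.2)) := by
  have hd' : (0 : ℝ) < d := by exact_mod_cast hd
  have hσ : 0 < d * ell d := mul_pos hd' (ell_pos hd)
  set b := latticeSplit hd (r, a) with hb
  have h1 := Measure.integral_comp_smul (volume : Measure (Fin n → ℝ))
    (fun q => starRingEnd ℂ (φ q) *
      (phase (ell d * (b.toPhase.2 ⬝ᵥ q)) * ψ (q - ell d • b.toPhase.1))) (d * ell d)
  rw [Module.finrank_fin_fun, abs_of_nonneg (by positivity)] at h1
  have h2 : ∀ x, starRingEnd ℂ (scaled d φ 0 x) * (phase (2 * Real.pi * (a.toPhase.1 ⬝ᵥ x)) *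
        scaled d ψ ((d : ℝ)⁻¹ • natVec r) (x + a.toPhase.2)) =
      starRingEnd ℂ (φ ((d * ell d) • x)) * (phase (ell d * (b.toPhase.2 ⬝ᵥ ((d * ell d) • x))) *
        ψ ((d * ell d) • x - ell d • b.toPhase.1)) := fun x => by
    have h3 : b.toPhase.2 = a.toPhase.1 := rfl
    have h4 : b.toPhase.1 = natVec r - (d : ℝ) • a.toPhase.2 := by
      ext k
      simp [hb, Lattice.toPhase, latticeSplit, intSplit, natVec]
    rw [scaled, scaled, sub_zero, h3, h4, dotProduct_smul, smul_eq_mul, ← mul_assoc (ell d),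
      ell_mul_period hd]
    congr 3
    rw [smul_sub, smul_add, smul_smul, mul_right_comm, mul_inv_cancel₀ hd'.ne', one_mul, smul_sub,
      smul_smul, mul_comm (ell d) (d : ℝ)]
    abel
  simp only [h2]
  rw [h1, Complex.real_smul, ← mul_assoc, ← Complex.ofReal_mul, mul_inv_cancel₀ (by positivity),
    Complex.ofReal_one, one_mul, corr]

/-- The identity behind the expansion of the twirl: Parseval for each residue r, then the sum over
r. The constants match because dℓ² = 2π. -/
theorem tsum_corr_mul_conj (hd : 0 < d) (φ α β ψ : 𝓢(Fin n → ℝ, ℂ)) :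
    ∑' b : Lattice n, corr d φ ψ b.toPhase * starRingEnd ℂ (corr d α β b.toPhase) =
      (2 * (Real.pi : ℂ)) ^ n * ∫ s, gkpForm d s φ α * gkpForm d s β ψ ∂cellMeasure n d := by
  have hd' : (0 : ℝ) < d := by exact_mod_cast hd
  have hl := ell_pos hd
  have hs : Summable fun b : Lattice n =>
      corr d φ ψ b.toPhase * starRingEnd ℂ (corr d α β b.toPhase) := by
    refine Summable.of_norm_bounded ((summable_norm_corr hd φ ψ).mul_right
      (‖α.toLp 2 volume‖ * ‖β.toLp 2 volume‖)) fun b => ?_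
    rw [norm_mul, RCLike.norm_conj]
    exact mul_le_mul_of_nonneg_left (norm_corr_le hd α β _) (norm_nonneg _)
  have h1 : ∀ r : Fin n → Fin d, ∑' a : Lattice n,
      corr d φ ψ (latticeSplit hd (r, a)).toPhase *
        starRingEnd ℂ (corr d α β (latticeSplit hd (r, a)).toPhase) =
      (((d * ell d) ^ (2 * n) : ℝ) : ℂ) * ∫ x in box n 1,
        zakProd d φ α x.1 x.2 * zakProd d β ψ (x.1 - (d : ℝ)⁻¹ • natVec r) x.2 := fun r => by
    have h := (isWiener_scaled hd φ 0).hasSum_mul_conj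
      (isWiener_scaled hd ψ ((d : ℝ)⁻¹ • natVec r)) (isWiener_scaled hd α 0)
      (isWiener_scaled hd β ((d : ℝ)⁻¹ • natVec r))
    have h2 := (h.mul_left (((d * ell d) ^ (2 * n) : ℝ) : ℂ)).tsum_eq
    refine Eq.trans (tsum_congr fun a => ?_) (h2.trans ?_)
    · rw [corr_latticeSplit, corr_latticeSplit, map_mul, Complex.conj_ofReal, mul_mul_mul_comm,
        ← Complex.ofReal_mul, ← pow_add, ← two_mul]
    · congr 1
      refine integral_congr_ae (Filter.Eventually.of_forall fun x => ?_)
      -- Parseval pairs φ with ψ and α with β; the same four factors are regrouped as (φ, α) at x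
      -- and (β, ψ) at the translate by r/d.
      simp only [zakProd, map_mul, Complex.conj_conj]
      rw [zak_scaled _ ((d : ℝ)⁻¹ • natVec r), zak_scaled _ ((d : ℝ)⁻¹ • natVec r)]
      ring
  rw [← (latticeSplit hd).tsum_eq]
  refine (((latticeSplit hd).summable_iff.2 hs).tsum_prod).trans ?_
  simp only [Function.comp_apply, h1]
  rw [tsum_fintype, ← Finset.mul_sum, sum_setIntegral_zakProd hd, cellMeasure,
    integral_smul_measure, ENNReal.toReal_ofReal (by positivity), Complex.real_smul, ← mul_assoc,
    ← mul_assoc]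
  congr 1
  have hpi : (2 * (Real.pi : ℂ)) ^ n = (((ell d * (d * ell d)) ^ n : ℝ) : ℂ) := by
    rw [ell_mul_period hd]; push_cast; rfl
  rw [hpi, ← Complex.ofReal_mul, ← Complex.ofReal_mul]
  congr 1
  field_simp
  ring

end GKP

/-! ### Schwartz expansions of trace-class operators -/

section SchwartzExpansion

variable {n d : ℕ}

/-- Density of Schwartz functions, with geometric control so that expanding both vectors of every
rank-one term preserves trace-norm summability. -/
theorem exists_schwartz_hasSum (x : Modes n) :
    ∃ a : ℕ → 𝓢(Fin n → ℝ, ℂ), (∀ k, ‖(a k).toLp 2 volume‖ ≤ 2 * ‖x‖ * (1 / 2) ^ k) ∧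
      HasSum (fun k => (a k).toLp 2 volume) x := by
  by_cases hx : x = 0
  · refine ⟨fun _ => 0, fun k => ?_, ?_⟩
    · rw [← SchwartzMap.toLpCLM_apply (𝕜 := ℂ), map_zero]; simp [hx]
    · simp only [← SchwartzMap.toLpCLM_apply (𝕜 := ℂ), map_zero, hx]
      exact hasSum_zero
  · have hpos := norm_pos_iff.2 hx
    let L := SchwartzMap.toLpCLM (E := Fin n → ℝ) ℂ ℂ 2 volume
    have hdense : DenseRange L := by
      have := SchwartzMap.denseRange_toLpCLM (E := Fin n → ℝ) (F := ℂ) (p := 2) (by simp)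
        (μ := volume)
      exact this
    have hcl : x ∈ closure (((L : 𝓢(Fin n → ℝ, ℂ) →ₗ[ℂ] Modes n).toAddMonoidHom.range :
        AddSubgroup (Modes n)) : Set (Modes n)) := by
      have h := hdense x
      simpa using! h
    -- The tolerances must be positive, whence the separate case x = 0. The zeroth term is only
    -- known to lie within ‖x‖ of x, which costs the factor 2.
    obtain ⟨v, hv, hvs, hv0, hvn⟩ := controlled_sum_of_mem_closure hcl
      (b := fun k => ‖x‖ * (1 / 2) ^ k) (fun k => by positivity)
    choose a ha using hvs
    have ha' : ∀ k, (a k).toLp 2 volume = v k := ha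
    have hb : ∀ k, ‖v k‖ ≤ 2 * ‖x‖ * (1 / 2) ^ k := fun k => by
      rcases Nat.eq_zero_or_pos k with rfl | hk
      · have h1 := norm_le_norm_add_norm_sub' (v 0) x
        rw [norm_sub_rev, sub_eq_neg_add] at h1
        simp only [pow_zero, mul_one] at hv0 ⊢
        linarith
      · refine (hvn k hk).le.trans ?_
        have : 0 ≤ ‖x‖ * (1 / 2) ^ k := by positivity
        linarith
    refine ⟨a, fun k => by rw [ha']; exact hb k, ?_⟩
    simp only [ha']
    have hs : Summable v := Summable.of_norm_bounded (summable_geometric_two.mul_left _) hb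
    have h1 := hs.hasSum.tendsto_sum_nat.comp (Filter.tendsto_add_atTop_nat 1)
    rw [← tendsto_nhds_unique h1 hv]
    exact hs.hasSum

theorem hasSum_rankOne_prod {x y : Modes n} {u v : ℕ → Modes n} (hu : HasSum u x) (hv : HasSum v y)
    (hs : Summable fun p : ℕ × ℕ => InnerProductSpace.rankOne ℂ (u p.1) (v p.2)) :
    HasSum (fun p : ℕ × ℕ => InnerProductSpace.rankOne ℂ (u p.1) (v p.2))
      (InnerProductSpace.rankOne ℂ x y) := by
  have h1 : ∀ k, HasSum (fun l => InnerProductSpace.rankOne ℂ (u k) (v l))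
      (InnerProductSpace.rankOne ℂ (u k) y) := fun k =>
    hv.map (InnerProductSpace.rankOne (F := Modes n) ℂ (u k))
      (InnerProductSpace.rankOne (F := Modes n) ℂ (u k)).continuous
  have h2 : HasSum (fun k => InnerProductSpace.rankOne ℂ (u k) y)
      (InnerProductSpace.rankOne ℂ x y) :=
    hu.map ((InnerProductSpace.rankOne (E := Modes n) (F := Modes n) ℂ).flip y)
      ((InnerProductSpace.rankOne (E := Modes n) (F := Modes n) ℂ).flip y).continuous
  rw [h2.unique (hs.hasSum.prod_fiberwise h1)]
  exact hs.hasSum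

theorem IsNuclearSum.comp_equiv {ι κ : Type*} {α β : ι → Modes n} {C : Modes n →L[ℂ] Modes n}
    (h : IsNuclearSum α β C) (e : κ ≃ ι) :
    IsNuclearSum (fun k => α (e k)) (fun k => β (e k)) C :=
  ⟨(e.summable_iff (f := fun i => ‖α i‖ * ‖β i‖)).2 h.1,
    (e.hasSum_iff (f := fun i => InnerProductSpace.rankOne ℂ (α i) (β i))).2 h.2⟩

theorem IsNuclearSum.refine {ι : Type*} {x y : ι → Modes n} {C : Modes n →L[ℂ] Modes n}
    (h : IsNuclearSum x y C)
    {a b : ι → ℕ → Modes n} (ha : ∀ i k, ‖a i k‖ ≤ 2 * ‖x i‖ * (1 / 2) ^ k)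
    (hb : ∀ i k, ‖b i k‖ ≤ 2 * ‖y i‖ * (1 / 2) ^ k) (hax : ∀ i, HasSum (a i) (x i))
    (hby : ∀ i, HasSum (b i) (y i)) :
    IsNuclearSum (fun p : ι × ℕ × ℕ => a p.1 p.2.1) (fun p => b p.1 p.2.2) C := by
  have hgeom : Summable fun p : ℕ × ℕ => (1 / 2 : ℝ) ^ p.1 * (1 / 2 : ℝ) ^ p.2 :=
    summable_geometric_two.mul_of_nonneg summable_geometric_two
      (fun _ => pow_nonneg one_half_pos.le _) fun _ => pow_nonneg one_half_pos.le _
  have hbig : Summable fun p : ι × ℕ × ℕ =>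
      (‖x p.1‖ * ‖y p.1‖) * ((1 / 2 : ℝ) ^ p.2.1 * (1 / 2 : ℝ) ^ p.2.2) :=
    summable_mul_prod h.1 hgeom (fun _ => mul_nonneg (norm_nonneg _) (norm_nonneg _))
      fun _ => mul_nonneg (pow_nonneg one_half_pos.le _) (pow_nonneg one_half_pos.le _)
  have hsum : Summable fun p : ι × ℕ × ℕ => ‖a p.1 p.2.1‖ * ‖b p.1 p.2.2‖ := by
    refine Summable.of_nonneg_of_le (fun p => mul_nonneg (norm_nonneg _) (norm_nonneg _))
      (fun p => ?_) (hbig.mul_left 4)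
    refine (mul_le_mul (ha _ _) (hb _ _) (norm_nonneg _) (by positivity)).trans_eq ?_
    ring
  have hop : Summable fun p : ι × ℕ × ℕ =>
      InnerProductSpace.rankOne ℂ (a p.1 p.2.1) (b p.1 p.2.2) :=
    Summable.of_norm (by simpa only [InnerProductSpace.norm_rankOne] using hsum)
  have h1 : ∀ i, HasSum (fun p : ℕ × ℕ => InnerProductSpace.rankOne ℂ (a i p.1) (b i p.2))
      (InnerProductSpace.rankOne ℂ (x i) (y i)) := fun i =>
    hasSum_rankOne_prod (hax i) (hby i) (hop.prod_factor i)
  have h2 := hop.hasSum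
  rw [(hop.hasSum.prod_fiberwise h1).unique h.2] at h2
  exact ⟨hsum, h2⟩

/-- Without such an expansion the condition `IsTwirl` would be vacuous; its existence is what makes
the twirl unique. -/
theorem IsTraceClass.exists_schwartz {C : Modes n →L[ℂ] Modes n} (hC : IsTraceClass C) :
    ∃ α β : ℕ → 𝓢(Fin n → ℝ, ℂ),
      IsNuclearSum (fun i => (α i).toLp 2 volume) (fun i => (β i).toLp 2 volume) C := by
  obtain ⟨x, y, hN⟩ := hC.exists_nuclearSum
  choose a ha hax using fun i => exists_schwartz_hasSum (x i)
  choose b hb hby using fun i => exists_schwartz_hasSum (y i)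
  let e := (Denumerable.eqv (ℕ × ℕ × ℕ)).symm
  exact ⟨fun i => a (e i).1 (e i).2.1, fun i => b (e i).1 (e i).2.2,
    (hN.refine ha hb hax hby).comp_equiv e⟩

end SchwartzExpansion

/-! ### The twirl -/

section Twirl

variable {n d : ℕ} {C D : Modes n →L[ℂ] Modes n}

/-- Displacements have norm at most one, so absolute summability of the coefficients gives
convergence in operator norm. -/
theorem HasWigner.summable_charFn_smul_disp (hC : HasWigner d C) :
    Summable fun a : Lattice n => charFn d C (-a) • disp d a.toPhase := by
  have h : Summable fun a : Lattice n => ‖charFn d C a‖ := hC.2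
  have h' : Summable fun a : Lattice n => ‖charFn d C (-a)‖ :=
    (Equiv.neg (Lattice n)).summable_iff.2 h
  refine Summable.of_norm (Summable.of_nonneg_of_le (fun _ => norm_nonneg _) (fun a => ?_) h')
  rw [norm_smul]
  exact mul_le_of_le_one_right (norm_nonneg _) (norm_disp_le _)

/-- The expansion `(2π)⁻ⁿ ∑_a Tr (C T_a†) T_a` of the twirl in integer displacements. -/
def twirlSeries (d : ℕ) (C : Modes n →L[ℂ] Modes n) : Modes n →L[ℂ] Modes n :=
  (1 / (2 * (Real.pi : ℂ)) ^ n) • ∑' a : Lattice n, charFn d C (-a) • disp d a.toPhase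

theorem corr_mul_conj_corr (hd : 0 < d) (φ ψ α β : 𝓢(Fin n → ℝ, ℂ)) (a : Lattice n) :
    corr d φ ψ a.toPhase * starRingEnd ℂ (corr d α β a.toPhase) =
      ⟪φ.toLp 2 volume, disp d a.toPhase (ψ.toLp 2 volume)⟫_ℂ *
        ⟪β.toLp 2 volume, disp d (-a).toPhase (α.toLp 2 volume)⟫_ℂ := by
  rw [Lattice.toPhase_neg, ← adjoint_disp hd, ContinuousLinearMap.adjoint_inner_right,
    ← inner_conj_symm (disp d a.toPhase (β.toLp 2 volume)), inner_disp_toLp hd,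
    inner_disp_toLp hd, map_mul, mul_mul_mul_comm, conj_phase, ← phase_add, add_neg_cancel,
    phase_zero, one_mul]

/-- Exchanges the lattice sum with the nuclear expansion. The majorant ‖α_i‖‖β_i‖ |⟨φ, T_a ψ⟩| is a
product of summable families. -/
theorem HasWigner.hasSum_inner_twirlSeries (hC : HasWigner d C) {α β : ℕ → Modes n}
    (hN : IsNuclearSum α β C) {φ ψ : Modes n}
    (hφψ : Summable fun a : Lattice n => ‖⟪φ, disp d a.toPhase ψ⟫_ℂ‖) :
    HasSum (fun i => 1 / (2 * (Real.pi : ℂ)) ^ n * ∑' a : Lattice n,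
      ⟪φ, disp d a.toPhase ψ⟫_ℂ * ⟪β i, disp d (-a).toPhase (α i)⟫_ℂ)
      ⟪φ, twirlSeries d C ψ⟫_ℂ := by
  obtain ⟨G, hGdef⟩ : ∃ G : ℕ × Lattice n → ℂ, ∀ i a, G (i, a) =
      ⟪φ, disp d a.toPhase ψ⟫_ℂ * ⟪β i, disp d (-a).toPhase (α i)⟫_ℂ :=
    ⟨fun p => ⟪φ, disp d p.2.toPhase ψ⟫_ℂ * ⟪β p.1, disp d (-p.2).toPhase (α p.1)⟫_ℂ,
      fun _ _ => rfl⟩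
  have hbig : Summable fun p : ℕ × Lattice n =>
      (‖α p.1‖ * ‖β p.1‖) * ‖⟪φ, disp d p.2.toPhase ψ⟫_ℂ‖ :=
    summable_mul_prod hN.1 hφψ (fun _ => mul_nonneg (norm_nonneg _) (norm_nonneg _))
      fun _ => norm_nonneg _
  have hG : Summable G := by
    refine Summable.of_norm_bounded hbig fun ⟨i, a⟩ => ?_
    have h := norm_inner_le_norm (𝕜 := ℂ) (β i) (disp d (-a).toPhase (α i))
    rw [norm_disp_apply, mul_comm] at h
    rw [hGdef, norm_mul, mul_comm]
    exact mul_le_mul_of_nonneg_right h (norm_nonneg _)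
  have h1 : ∀ a : Lattice n, HasSum (fun i => G (i, a))
      (⟪φ, disp d a.toPhase ψ⟫_ℂ * charFn d C (-a)) := fun a => by
    have h := (hN.mul_left (disp d (-a).toPhase)).hasSum_trace
    rw [hC.1.trace_mul_comm] at h
    simp only [hGdef]
    exact h.mul_left ⟪φ, disp d a.toPhase ψ⟫_ℂ
  have h2 : HasSum (fun a : Lattice n => ⟪φ, disp d a.toPhase ψ⟫_ℂ * charFn d C (-a))
      ⟪φ, (∑' a : Lattice n, charFn d C (-a) • disp d a.toPhase) ψ⟫_ℂ := by
    have h := (hC.summable_charFn_smul_disp.hasSum.mapL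
      (ContinuousLinearMap.apply ℂ (Modes n) ψ)).mapL (innerSL ℂ φ)
    refine h.congr_fun fun a => ?_
    simp [mul_comm]
  have h3 := ((Equiv.prodComm _ _).symm.hasSum_iff.2 hG.hasSum).prod_fiberwise h1
  have h4 := hG.hasSum.prod_fiberwise fun i => (hG.prod_factor i).hasSum
  rw [h3.unique h2] at h4
  rw [twirlSeries, smul_apply, inner_smul_right]
  simp only [← hGdef]
  exact h4.mul_left (1 / (2 * (Real.pi : ℂ)) ^ n)

theorem HasWigner.isTwirl (hd : 0 < d) (hC : HasWigner d C) : IsTwirl d C (twirlSeries d C) := by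
  intro α β hs hsum φ ψ
  refine ⟨fun i => integrable_gkpForm_mul hd φ (α i) (β i) ψ, ?_⟩
  have hpi : (2 * (Real.pi : ℂ)) ^ n ≠ 0 := by simp [Real.pi_ne_zero]
  refine (hC.hasSum_inner_twirlSeries ⟨hs, hsum⟩ (summable_norm_inner_disp hd φ ψ)).congr_fun
    fun i => ?_
  simp only [← corr_mul_conj_corr hd]
  rw [tsum_corr_mul_conj hd, ← mul_assoc, one_div_mul_cancel hpi, one_mul]

/-- One Schwartz expansion fixes all matrix elements between Schwartz functions, and these are
dense. -/
theorem IsTwirl.unique {E E' : Modes n →L[ℂ] Modes n} (hC : IsTraceClass C) (h : IsTwirl d C E)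
    (h' : IsTwirl d C E') : E = E' := by
  obtain ⟨α, β, hN⟩ := hC.exists_schwartz
  have hdense : DenseRange (fun φ : 𝓢(Fin n → ℝ, ℂ) => φ.toLp 2 volume) :=
    SchwartzMap.denseRange_toLpCLM (E := Fin n → ℝ) (F := ℂ) (p := 2) (by simp) (μ := volume)
  have key : ∀ φ ψ : 𝓢(Fin n → ℝ, ℂ), ⟪φ.toLp 2 volume, E (ψ.toLp 2 volume)⟫_ℂ =
      ⟪φ.toLp 2 volume, E' (ψ.toLp 2 volume)⟫_ℂ := fun φ ψ =>
    (h α β hN.1 hN.2 φ ψ).2.unique (h' α β hN.1 hN.2 φ ψ).2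
  have h1 : ∀ ψ : 𝓢(Fin n → ℝ, ℂ), E (ψ.toLp 2 volume) = E' (ψ.toLp 2 volume) := fun ψ => by
    refine ext_inner_left ℂ fun x => ?_
    exact congrFun (hdense.equalizer (g := fun x => ⟪x, E (ψ.toLp 2 volume)⟫_ℂ)
      (h := fun x => ⟪x, E' (ψ.toLp 2 volume)⟫_ℂ) (by fun_prop) (by fun_prop)
      (funext fun φ => key φ ψ)) x
  ext1 x
  exact congrFun (hdense.equalizer E.continuous E'.continuous (funext h1)) x

theorem HasWigner.twirl_eq (hd : 0 < d) (hC : HasWigner d C) : twirl d C = twirlSeries d C := by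
  have h : ∃ E, IsTwirl d C E := ⟨_, hC.isTwirl hd⟩
  rw [twirl, dif_pos h]
  exact IsTwirl.unique hC.1 (Classical.choose_spec h) (hC.isTwirl hd)

/-- Norm convergence of the series and norm continuity of A ↦ Tr(A D) allow the trace to be taken
term by term. -/
theorem HasWigner.trace_twirlSeries_mul (hC : HasWigner d C) (hD : HasWigner d D) :
    trace (twirlSeries d C * D) =
      1 / (2 * (Real.pi : ℂ)) ^ n * ∑' a, charFn d C (-a) * charFn d D a := by
  rw [twirlSeries, smul_mul_assoc, trace_smul]
  congr 1
  refine (hD.1.hasSum_trace_mul hC.summable_charFn_smul_disp.hasSum).tsum_eq.symm.trans ?_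
  refine tsum_congr fun a => ?_
  rw [smul_mul_assoc, trace_smul, hD.1.trace_mul_comm, charFn, charFn]

/-- The trace per stabilizer as a continuous linear functional. -/
def cellTraceCLM (n d : ℕ) : (Modes n →L[ℂ] Modes n) →L[ℂ] ℂ :=
  ((2 * Real.pi / d : ℝ) : ℂ) ^ n • ∑ j : Fin n → Fin d,
    (innerSL ℂ (cellVec d j)).comp (ContinuousLinearMap.apply ℂ (Modes n) (cellVec d j))

theorem cellTraceCLM_apply (X : Modes n →L[ℂ] Modes n) : cellTraceCLM n d X = cellTrace d X := by
  simp [cellTraceCLM, cellTrace]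

/-- In the double series T_a T_b is a phase times T_{a+b}, so τ keeps only b = -a, where the phase
is trivial because [a, a] = 0. The value (2π)ⁿ cancels one prefactor. -/
theorem HasWigner.cellTrace_twirlSeries_mul (hd : 0 < d) (hC : HasWigner d C)
    (hD : HasWigner d D) :
    cellTrace d (twirlSeries d C * twirlSeries d D) =
      1 / (2 * (Real.pi : ℂ)) ^ n * ∑' a, charFn d C (-a) * charFn d D a := by
  have hpi : (2 * (Real.pi : ℂ)) ^ n ≠ 0 := by simp [Real.pi_ne_zero]
  have h1 : ∀ a : Lattice n, cellTraceCLM n d (disp d a.toPhase *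
      ∑' b : Lattice n, charFn d D (-b) • disp d b.toPhase) =
      (2 * (Real.pi : ℂ)) ^ n * charFn d D a := fun a => by
    refine ((hD.summable_charFn_smul_disp.hasSum.mul_left (disp d a.toPhase)).mapL
      (cellTraceCLM n d)).tsum_eq.symm.trans ?_
    have h2 : ∀ b : Lattice n,
        cellTraceCLM n d (disp d a.toPhase * charFn d D (-b) • disp d b.toPhase) =
        charFn d D (-b) * (phase (-(Real.pi * symp a.toPhase b.toPhase / d)) *
          if a + b = 0 then (2 * (Real.pi : ℂ)) ^ n else 0) := fun b => by
      rw [mul_smul_comm, disp_mul_disp hd, ← Lattice.toPhase_add, map_smul, map_smul,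
        cellTraceCLM_apply, cellTrace_disp hd, smul_eq_mul, smul_eq_mul]
    simp only [h2]
    rw [tsum_eq_single (-a) fun b hb => by
      rw [if_neg fun h => hb (eq_neg_of_add_eq_zero_right h), mul_zero, mul_zero]]
    rw [if_pos (add_neg_cancel a), neg_neg, Lattice.toPhase_neg, symp_neg_right, symp_self]
    simp [phase_zero, mul_comm]
  have h3 := ((hC.summable_charFn_smul_disp.hasSum.mul_right
    (∑' b : Lattice n, charFn d D (-b) • disp d b.toPhase)).mapL (cellTraceCLM n d)).tsum_eq
  simp only [smul_mul_assoc, map_smul, h1, smul_eq_mul] at h3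
  rw [twirlSeries, twirlSeries, smul_mul_smul_comm, ← cellTraceCLM_apply, map_smul, ← h3,
    smul_eq_mul, mul_assoc, ← tsum_mul_left]
  congr 1
  refine tsum_congr fun a => ?_
  rw [mul_left_comm (charFn d C (-a)), ← mul_assoc, one_div_mul_cancel hpi, one_mul]

end Twirl

end ZakGross

end

/-! ### Assembly of the five properties. -/

theorem lemma2 (n d : ℕ) (hd : Odd d) :
    -- linearity
    (∀ C D : ZakGross.Modes n →L[ℂ] ZakGross.Modes n,
      ZakGross.HasWigner d C → ZakGross.HasWigner d D →
        ZakGross.HasWigner d (C + D) ∧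
        ∀ η, ZakGross.wigner d (C + D) η = ZakGross.wigner d C η + ZakGross.wigner d D η) ∧
    (∀ (c : ℂ) (C : ZakGross.Modes n →L[ℂ] ZakGross.Modes n), ZakGross.HasWigner d C →
        ZakGross.HasWigner d (c • C) ∧
        ∀ η, ZakGross.wigner d (c • C) η = c * ZakGross.wigner d C η) ∧
    -- reality
    (∀ C : ZakGross.Modes n →L[ℂ] ZakGross.Modes n, ZakGross.HasWigner d C →
        ZakGross.HasWigner d (ContinuousLinearMap.adjoint C) ∧
        ∀ η, ZakGross.wigner d (ContinuousLinearMap.adjoint C) η =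
          starRingEnd ℂ (ZakGross.wigner d C η)) ∧
    -- standardization
    (∀ C : ZakGross.Modes n →L[ℂ] ZakGross.Modes n, ZakGross.HasWigner d C →
        MeasureTheory.Integrable (ZakGross.wigner d C) (ZakGross.torusMeasure n d) ∧
        ∫ η, ZakGross.wigner d C η ∂ZakGross.torusMeasure n d = ZakGross.trace C) ∧
    -- covariance under all real displacements
    (∀ C : ZakGross.Modes n →L[ℂ] ZakGross.Modes n, ZakGross.HasWigner d C →
      ∀ b : ZakGross.Phase n,
        ZakGross.HasWigner d
          (ZakGross.disp d b * C * ContinuousLinearMap.adjoint (ZakGross.disp d b)) ∧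
        ∀ η, ZakGross.wigner d
            (ZakGross.disp d b * C * ContinuousLinearMap.adjoint (ZakGross.disp d b)) η =
          ZakGross.wigner d C (η - ZakGross.ell d • b)) ∧
    -- traciality
    (∀ C D : ZakGross.Modes n →L[ℂ] ZakGross.Modes n,
      ZakGross.HasWigner d C → ZakGross.HasWigner d D →
        ZakGross.IsTwirl d C (ZakGross.twirl d C) ∧
        ZakGross.IsTwirl d D (ZakGross.twirl d D) ∧
        ZakGross.IsTraceClass (ZakGross.twirl d C * D) ∧
        ZakGross.IsTraceClass (C * ZakGross.twirl d D) ∧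
        MeasureTheory.Integrable (fun η => ZakGross.wigner d C η * ZakGross.wigner d D η)
          (ZakGross.torusMeasure n d) ∧
        ∫ η, ZakGross.wigner d C η * ZakGross.wigner d D η ∂ZakGross.torusMeasure n d =
          ZakGross.trace (ZakGross.twirl d C * D) ∧
        ZakGross.trace (ZakGross.twirl d C * D) = ZakGross.trace (C * ZakGross.twirl d D) ∧
        ZakGross.trace (C * ZakGross.twirl d D) =
          ZakGross.cellTrace d (ZakGross.twirl d C * ZakGross.twirl d D)) := by
  have hd0 : 0 < d := hd.pos
  refine ⟨fun C D hC hD => hC.add hD, fun c C hC => hC.smul c, fun C hC => hC.adjoint hd0,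
    fun C hC => hC.integral_wigner hd0, fun C hC b => hC.conj_disp hd0 b, fun C D hC hD => ?_⟩
  rw [hC.twirl_eq hd0, hD.twirl_eq hd0]
  have h1 := hC.trace_twirlSeries_mul hD
  have h2 := hD.trace_twirlSeries_mul hC
  rw [hC.1.trace_mul_comm] at h2
  -- The substitution a ↦ -a shows that it does not matter which of the two operators is twirled.
  have h3 : ∑' a, ZakGross.charFn d C (-a) * ZakGross.charFn d D a =
      ∑' a, ZakGross.charFn d C a * ZakGross.charFn d D (-a) := by
    rw [← (Equiv.neg (ZakGross.Lattice n)).tsum_eq]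
    simp
  have h4 : ZakGross.trace (ZakGross.twirlSeries d C * D) =
      ZakGross.trace (C * ZakGross.twirlSeries d D) := by
    rw [h1, h2, h3]
    simp only [mul_comm]
  refine ⟨hC.isTwirl hd0, hD.isTwirl hd0, hD.1.mul_left _, hC.1.mul_right _,
    (hC.integral_wigner_mul hd0 hD).1, ?_, h4, ?_⟩
  · rw [(hC.integral_wigner_mul hd0 hD).2, h1, h3]
  · rw [← h4, h1, hC.cellTrace_twirlSeries_mul hd0 hD]
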